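/- Let $r=2^{-1/2}$ and $\gamma=(1+i)/\sqrt2$, and write $B_\rho$ for the open disc of radius $\rho$ about $0$ in $\mathbb C$. (a) On $B_r$ the initial value problem $s'=(1-s^4)^{1/2}$ (principal square root), $s(0)=0$, has a unique solution $s_0$. There is a function $c_0$ such that $(s_0,c_0)$ is the unique solution on $B_r$ of $$s'=c(1+s^2),\quad c'=-s(1+c^2);\qquad s(0)=0,\quad c(0)=1 .$$ Define $s_1$ on $B_{2r}$ and then $s_2$ on $B_{4r}$ by $$s_{j+1}(2w)=\frac{2s_j(w)s_j'(w)}{1+s_j(w)^4},\qquad w\in B_{2^jr},\ j=0,1,$$ where $s_2$ is defined off the points $2w$ with $s_1(w)^4=-1$. There is a unique $K\in(0,1)$ with $s_1(K\gamma)=\gamma$ and a unique $L\in[0,\tfrac12\pi]$ with $s_2(L)=1$; moreover $L>0$. (b) There is a unique meromorphic function $s$ on $\mathbb C$ with $s=s_0$ on $B_r$. It satisfies $s=s_1$ on $B_{2r}$ and $s=s_2$ on $B_{4r}\setminus\{\pm2K\gamma,\pm2K\overline\gamma\}$. (c) $s$ is elliptic: $4L$ and $4iL$ are periods of $s$. Let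 $$P=\{\pm 2K\gamma,\ \pm2K\overline\gamma\}+4L\mathbb Z+4iL\mathbb Z .$$ Then $s$ is holomorphic on $\mathbb C\setminus P$ and has a simple pole at each point of $P$. (d) $s(0)=0$, $s'(0)=1$, and $(s')^2=1-s^4$ and $s''=-2s^3$ on $\mathbb C\setminus P$. There is a meromorphic function $c$ on $\mathbb C$ with $c=c_0$ on $B_r$ such that $c$ is holomorphic and $$s'=c(1+s^2),\qquad c'=-s(1+c^2),\qquad s^2+s^2c^2+c^2=1$$ at every point of $\mathbb C\setminus P$ at which $1+s^2\ne0$. (e) As identities of meromorphic functions on $\mathbb C$: $s(\overline z)=\overline{s(z)}$, $s(-z)=-s(z)$, $s(iz)=i\,s(z)$ and $s(2L-z)=s(z)$. (f) Let $z\in\mathbb C\setminus P$. Then $2z\in P$ if and only if $1+s(z)^4=0$, and otherwise $$s(2z)=\frac{2s(z)s'(z)}{1+s(z)^4}.$$ Also $\sqrt2\,\overline\gamma z\in P$ if and only if $1-s(z)^4=0$, and otherwise $$s(\sqrt2\,\overline\gamma\, z)^2=-2i\,\frac{s(z)^2}{1-s(z)^4}.$$ -/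

import Mathlib

open Complex Metric Set

namespace Lemniscatic

noncomputable section

/-- The radius `r = 2 ^ (-1/2)`. -/
def r : ℝ := 1 / Real.sqrt 2

/-- `γ = (1 + i) / √2`, the square root of `i` in the positive quadrant. -/
def γ : ℂ := (1 + I) / (Real.sqrt 2 : ℂ)

/-- `s` solves `s' = (1 - s ^ 4) ^ (1/2)` (principal square root), `s 0 = 0`, on the set `U`. -/
structure SolvesSineIVP (s : ℂ → ℂ) (U : Set ℂ) : Prop where
  zero : s 0 = 0
  hasDerivAt : ∀ z ∈ U, HasDerivAt s ((1 - s z ^ 4) ^ (1 / 2 : ℂ)) z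

/-- The pair `(s, c)` solves `s' = c (1 + s ^ 2)`, `c' = - s (1 + c ^ 2)`, `s 0 = 0`, `c 0 = 1`,
on the set `U`. -/
structure SolvesIVP (s c : ℂ → ℂ) (U : Set ℂ) : Prop where
  s_zero : s 0 = 0
  c_zero : c 0 = 1
  hasDerivAt_s : ∀ z ∈ U, HasDerivAt s (c z * (1 + s z ^ 2)) z
  hasDerivAt_c : ∀ z ∈ U, HasDerivAt c (-s z * (1 + c z ^ 2)) z

/-- The function `S` defined from `s` by duplication: `S (2 w) = 2 s(w) s'(w) / (1 + s(w) ^ 4)`.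
If `s` is given on the disc of radius `ρ`, then `S` is given on the disc of radius `2 ρ`. -/
def dup (s : ℂ → ℂ) (z : ℂ) : ℂ :=
  2 * s (z / 2) * deriv s (z / 2) / (1 + s (z / 2) ^ 4)

/-- The four points `± 2 K γ`, `± 2 K γ̄`. -/
def basicPoles (K : ℝ) : Set ℂ :=
  {2 * K * γ, -(2 * K * γ), 2 * K * starRingEnd ℂ γ, -(2 * K * starRingEnd ℂ γ)}

/-- The points congruent to one of the four basic points modulo the periods `4 L` and `4 i L`. -/
def poles (K L : ℝ) : Set ℂ :=
  {z | ∃ p ∈ basicPoles K, ∃ m n : ℤ, z = p + m * (4 * L) + n * (4 * I * L)}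

end

end Lemniscatic

namespace Lemniscatic

open Filter Topology

/-! Inverting the integral of (1 - t⁴)^(-1/2) gives a germ s at 0 with s'² = 1 - s⁴, and this
equation, with value and nonzero derivative prescribed at a point, has only one analytic solution
(`eventuallyEq_of_deriv_sq`). So a transformation law for s holds as soon as both sides satisfy the
same rescaled equation. The law s((1-i)z) = (1-i)s(z)/s'(z) continues s meromorphically to discs
growing by the factor |1-i| = √2, hence to a function S on the plane, and the identity theorem
carries every law from germs to S. Normal form (value 0 at poles) turns identities off discrete sets
into identities everywhere.

Quantitatively, |S| ≤ √2|z| on the disc of radius r; duplication and multiplication by 1-i push the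
absence of zeros other than 0 out to |z| < 2. On the ray through γ the equation becomes ρ' =
√(1+ρ⁴), which yields K, and (1-i)γ = √2 gives S(L) = 1 for L = √2 K.

The same uniqueness principle at L identifies S(L-z) with S'/(1+S²), which serves as c. Evenness of
this quotient gives the reflection about L and the antiperiods 2L, 2iL. Applying it twice gives
S(z+(1+i)L)S(z) = -i, so translation by (1+i)L exchanges zeros and poles. The square of half-side L
lies in |z| < 2, so the zeros are exactly the lattice 2Lℤ + 2iLℤ, all simple, and the poles are its
translate. -/

/-! ### Identity theorems and uniqueness for the differential equation. -/

/-- Identity theorem for meromorphic functions on a preconnected set. -/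
lemma eventuallyEq_nhdsNE_of_isPreconnected {f g : ℂ → ℂ} {U : Set ℂ} {x y : ℂ}
    (hf : MeromorphicOn f U) (hg : MeromorphicOn g U) (hU : IsPreconnected U) (hx : x ∈ U)
    (hy : y ∈ U) (h : f =ᶠ[𝓝[≠] x] g) : f =ᶠ[𝓝[≠] y] g := by
  have hfg : MeromorphicOn (f - g) U := hf.sub hg
  have key : meromorphicOrderAt (f - g) y = ⊤ := by
    by_contra hne
    refine hfg.meromorphicOrderAt_ne_top_of_isPreconnected hU hy hx hne ?_
    rw [meromorphicOrderAt_eq_top_iff]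
    filter_upwards [h] with z hz
    simp [hz]
  rw [meromorphicOrderAt_eq_top_iff] at key
  filter_upwards [key] with z hz
  simpa [sub_eq_zero] using hz

/-- Identity theorem for meromorphic functions on the plane. -/
lemma eventuallyEq_nhdsNE_of_meromorphic {f g : ℂ → ℂ} (hf : Meromorphic f) (hg : Meromorphic g)
    {x : ℂ} (h : f =ᶠ[𝓝[≠] x] g) (y : ℂ) : f =ᶠ[𝓝[≠] y] g :=
  eventuallyEq_nhdsNE_of_isPreconnected hf.meromorphicOn hg.meromorphicOn isPreconnected_univ
    (mem_univ x) (mem_univ y) h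

lemma eq_of_meromorphicNFOn {f g : ℂ → ℂ} (hf : MeromorphicNFOn f univ)
    (hg : MeromorphicNFOn g univ) {x : ℂ} (h : f =ᶠ[𝓝[≠] x] g) : f = g := by
  funext y
  have h1 := eventuallyEq_nhdsNE_of_meromorphic (fun z => (hf (mem_univ z)).meromorphicAt)
    (fun z => (hg (mem_univ z)).meromorphicAt) h y
  exact (((hf (mem_univ y)).eventuallyEq_nhdsNE_iff_eventuallyEq_nhds (hg (mem_univ y))).1
    h1).self_of_nhds

/-- Two solutions of `f' ^ 2 = κ (1 - f ^ 4)` with the same initial data agree, if the initial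
derivative is not zero. -/
lemma eventuallyEq_of_deriv_sq {f g : ℂ → ℂ} {x κ : ℂ} (hf : AnalyticAt ℂ f x)
    (hg : AnalyticAt ℂ g x) (hf' : ∀ᶠ z in 𝓝 x, deriv f z ^ 2 = κ * (1 - f z ^ 4))
    (hg' : ∀ᶠ z in 𝓝 x, deriv g z ^ 2 = κ * (1 - g z ^ 4)) (h0 : f x = g x)
    (h1 : deriv f x = deriv g x) (h2 : deriv g x ≠ 0) : f =ᶠ[𝓝 x] g := by
  have hh : AnalyticAt ℂ (f - g) x := hf.sub hg
  have hd : deriv (f - g) =ᶠ[𝓝 x] deriv f - deriv g := by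
    filter_upwards [hf.eventually_analyticAt, hg.eventually_analyticAt] with z hz1 hz2
    exact deriv_sub hz1.differentiableAt hz2.differentiableAt
  set q : ℂ → ℂ := fun z => -κ * (f z ^ 3 + f z ^ 2 * g z + f z * g z ^ 2 + g z ^ 3) with hq
  have hqa : AnalyticAt ℂ q x := by fun_prop
  have hpa : AnalyticAt ℂ (deriv f + deriv g) x := hf.deriv.add hg.deriv
  have hp0 : (deriv f + deriv g) x ≠ 0 := by
    simp only [Pi.add_apply, h1, ← two_mul]
    exact mul_ne_zero two_ne_zero h2
  -- Subtract the two equations and factor. Since f' + g' is a unit at x, f - g vanishes at most to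
  -- the order of its derivative, which forces infinite order.
  have hmul : (deriv f + deriv g) * deriv (f - g) =ᶠ[𝓝 x] (f - g) * q := by
    filter_upwards [hd, hf', hg'] with z hz hz1 hz2
    simp only [Pi.mul_apply, Pi.add_apply, Pi.sub_apply, hz, hq]
    linear_combination hz1 - hz2
  have hord := analyticOrderAt_congr hmul
  rw [analyticOrderAt_mul hpa hh.deriv, analyticOrderAt_mul hh hqa,
    hpa.analyticOrderAt_eq_zero.2 hp0, zero_add] at hord
  have hord' := hh.analyticOrderAt_deriv_add_one
  have hx0 : (f - g) x = 0 := by simp [h0]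
  have hfun : (fun z => (f - g) z - (f - g) x) = f - g := by
    funext z; simp [hx0]
  rw [hfun] at hord'
  by_cases htop : analyticOrderAt (f - g) x = ⊤
  · rw [analyticOrderAt_eq_top] at htop
    filter_upwards [htop] with z hz
    simpa [sub_eq_zero] using hz
  · exfalso
    have hle : analyticOrderAt (f - g) x + 1 ≤ analyticOrderAt (f - g) x := by
      conv_rhs => rw [← hord', hord]
      gcongr
      exact le_self_add
    exact absurd ((ENat.lt_add_one_iff htop).2 le_rfl) (not_lt.2 hle)

/-! ### The germ at the origin and its transformation laws. -/

lemma cpow_half_sq (z : ℂ) : (z ^ (1 / 2 : ℂ)) ^ 2 = z := by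
  rw [one_div]
  exact cpow_nat_inv_pow z two_ne_zero

/-- Local inverse of a primitive F of (1 - t⁴)^(-1/2) on the unit disc: the inverse has derivative
1/F'(s), whose square is 1 - s⁴. -/
lemma exists_local_sine : ∃ s : ℂ → ℂ, AnalyticAt ℂ s 0 ∧ s 0 = 0 ∧ deriv s 0 = 1 ∧
    ∀ᶠ z in 𝓝 0, deriv s z ^ 2 = 1 - s z ^ 4 := by
  set φ : ℂ → ℂ := fun t => (1 - t ^ 4) ^ (-(1 / 2) : ℂ) with hφ
  have hre : ∀ t ∈ ball (0 : ℂ) 1, 1 - t ^ 4 ∈ slitPlane := by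
    intro t ht
    refine Or.inl ?_
    have h1 : ‖t ^ 4‖ < 1 := by
      rw [norm_pow]
      exact pow_lt_one₀ (norm_nonneg _) (by simpa using ht) (by norm_num)
    have h2 := (abs_le.1 (abs_re_le_norm (t ^ 4))).2
    simp only [sub_re, one_re]
    linarith
  have hφd : DifferentiableOn ℂ φ (ball 0 1) := by
    intro t ht
    have : DifferentiableAt ℂ φ t :=
      DifferentiableAt.cpow (by fun_prop) (by fun_prop) (hre t ht)
    exact this.differentiableWithinAt
  obtain ⟨F, hF0, hF⟩ := hφd.isExactOn_ball.with_val_at 0 0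
  have h0 : (0 : ℂ) ∈ ball (0 : ℂ) 1 := by simp
  have hFa : AnalyticAt ℂ F 0 := by
    refine DifferentiableOn.analyticAt (s := ball 0 1) ?_ (isOpen_ball.mem_nhds h0)
    exact fun z hz => (hF z hz).differentiableAt.differentiableWithinAt
  have hφ0 : φ 0 = 1 := by simp [hφ]
  have hd : deriv F 0 = 1 := by rw [(hF 0 h0).deriv, hφ0]
  have hd0 : deriv F 0 ≠ 0 := by simp [hd]
  set s := hFa.hasStrictDerivAt.localInverse _ _ _ hd0 with hs
  have hsa : AnalyticAt ℂ s 0 := hF0 ▸ hFa.analyticAt_localInverse hd0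
  have hs1 : HasStrictDerivAt s (deriv F 0)⁻¹ (F 0) := hFa.hasStrictDerivAt.to_localInverse hd0
  have hs2 : ∀ᶠ y in 𝓝 (F 0), F (s y) = y := HasStrictFDerivAt.eventually_right_inverse _
  have hs0 : s (F 0) = 0 := HasStrictFDerivAt.localInverse_apply_image _
  rw [hF0] at hs1 hs2 hs0
  rw [hd, inv_one] at hs1
  have hcont : Tendsto s (𝓝 0) (𝓝 0) := by
    have := hsa.continuousAt.tendsto
    rwa [hs0] at this
  have hev : ∀ᶠ z in 𝓝 (0 : ℂ), s z ∈ ball (0 : ℂ) 1 ∧ F (s z) = z :=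
    (hcont.eventually (isOpen_ball.mem_nhds h0)).and hs2
  have hφne : ∀ t ∈ ball (0 : ℂ) 1, φ t ≠ 0 := fun t ht => by
    simp only [hφ, ne_eq, cpow_eq_zero_iff, not_and_or]
    exact Or.inl (slitPlane_ne_zero (hre t ht))
  have hder : ∀ᶠ z in 𝓝 (0 : ℂ), HasDerivAt s (φ (s z))⁻¹ z := by
    filter_upwards [hev.eventually_nhds, hsa.eventually_analyticAt] with z hz hc
    have hz' := hz.self_of_nhds
    exact HasDerivAt.of_local_left_inverse hc.continuousAt (hF _ hz'.1) (hφne _ hz'.1)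
      (hz.mono fun w hw => hw.2)
  refine ⟨s, hsa, hs0, hs1.hasDerivAt.deriv, ?_⟩
  filter_upwards [hder] with z hz
  rw [hz.deriv]
  simp only [hφ, cpow_neg, inv_inv, cpow_half_sq]

/-- A germ at `0` of a solution of `s' ^ 2 = 1 - s ^ 4` with `s 0 = 0`, `s' 0 = 1`. -/
structure IsSineGerm (s : ℂ → ℂ) : Prop where
  analyticAt : AnalyticAt ℂ s 0
  zero : s 0 = 0
  deriv_zero : deriv s 0 = 1
  deriv_sq : ∀ᶠ z in 𝓝 0, deriv s z ^ 2 = 1 - s z ^ 4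

namespace IsSineGerm

variable {s t : ℂ → ℂ}

lemma eventuallyEq (hs : IsSineGerm s) (ht : IsSineGerm t) : s =ᶠ[𝓝 0] t := by
  refine eventuallyEq_of_deriv_sq (κ := 1) hs.analyticAt ht.analyticAt ?_ ?_
    (by rw [hs.zero, ht.zero]) (by rw [hs.deriv_zero, ht.deriv_zero]) (by simp [ht.deriv_zero])
  · simpa using hs.deriv_sq
  · simpa using ht.deriv_sq

lemma deriv_ne_zero (hs : IsSineGerm s) : ∀ᶠ z in 𝓝 0, deriv s z ≠ 0 :=
  hs.analyticAt.deriv.continuousAt.eventually_ne (by simp [hs.deriv_zero])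

lemma hasDerivAt (hs : IsSineGerm s) : ∀ᶠ z in 𝓝 0, HasDerivAt s (deriv s z) z :=
  hs.analyticAt.eventually_analyticAt.mono fun _ hz => hz.differentiableAt.hasDerivAt

lemma hasDerivAt_deriv (hs : IsSineGerm s) :
    ∀ᶠ z in 𝓝 0, HasDerivAt (deriv s) (-2 * s z ^ 3) z := by
  filter_upwards [hs.deriv_sq.eventually_nhds, hs.deriv_ne_zero, hs.hasDerivAt,
    hs.analyticAt.deriv.eventually_analyticAt] with z h1 h2 h3 h4
  have h5 : HasDerivAt (fun w => deriv s w ^ 2) (2 * deriv s z * deriv (deriv s) z) z := by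
    simpa using h4.differentiableAt.hasDerivAt.fun_pow 2
  have h6 : HasDerivAt (fun w => 1 - s w ^ 4) (-(4 * s z ^ 3 * deriv s z)) z := by
    simpa using (h3.pow 4).const_sub 1
  have h7 := h5.unique (h6.congr_of_eventuallyEq h1)
  have h8 : deriv (deriv s) z = -2 * s z ^ 3 := by
    apply mul_left_cancel₀ (mul_ne_zero two_ne_zero h2)
    linear_combination h7
  exact h8 ▸ h4.differentiableAt.hasDerivAt

lemma tendsto_mul (a : ℂ) : Tendsto (fun z : ℂ => a * z) (𝓝 0) (𝓝 0) := by
  have : ContinuousAt (fun z : ℂ => a * z) 0 := by fun_prop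
  simpa [ContinuousAt] using this

lemma analyticAt_comp_mul (hs : IsSineGerm s) (a : ℂ) : AnalyticAt ℂ (fun z => s (a * z)) 0 := by
  refine AnalyticAt.fun_comp (g := s) (f := fun z => a * z) ?_ (by fun_prop)
  simpa using hs.analyticAt

lemma deriv_comp_mul (a z : ℂ) : deriv (fun z => s (a * z)) z = a * deriv s (a * z) := by
  simpa using deriv_comp_mul_left a s z

lemma deriv_sq_comp_mul (hs : IsSineGerm s) (a : ℂ) :
    ∀ᶠ z in 𝓝 0, deriv (fun z => s (a * z)) z ^ 2 = a ^ 2 * (1 - s (a * z) ^ 4) := by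
  filter_upwards [(tendsto_mul a).eventually hs.deriv_sq] with z hz
  rw [deriv_comp_mul, mul_pow, hz]

/-- A germ that solves the differential equation of `s (a z)` is `s (a z)`. -/
lemma comp_mul_eq (hs : IsSineGerm s) {a : ℂ} (ha : a ≠ 0) {g : ℂ → ℂ} (hg : AnalyticAt ℂ g 0)
    (h0 : g 0 = 0) (h1 : deriv g 0 = a)
    (h2 : ∀ᶠ z in 𝓝 0, deriv g z ^ 2 = a ^ 2 * (1 - g z ^ 4)) :
    ∀ᶠ z in 𝓝 0, s (a * z) = g z := by
  refine eventuallyEq_of_deriv_sq (hs.analyticAt_comp_mul a) hg (hs.deriv_sq_comp_mul a) h2 ?_ ?_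
    (h1 ▸ ha)
  · simp [hs.zero, h0]
  · rw [deriv_comp_mul, h1, mul_zero, hs.deriv_zero, mul_one]

/-- The equation involves only s⁴, and i⁴ = 1. -/
lemma comp_I_mul (hs : IsSineGerm s) : ∀ᶠ z in 𝓝 0, s (I * z) = I * s z := by
  have hd : ∀ z, deriv (fun z => I * s z) z = I * deriv s z := fun z => by
    simp
  refine hs.comp_mul_eq I_ne_zero (analyticAt_const.mul hs.analyticAt) (by simp [hs.zero])
    (by simp [hd, hs.deriv_zero]) ?_
  filter_upwards [hs.deriv_sq] with z hz
  rw [hd, mul_pow, hz, mul_pow, I_pow_four, one_mul]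

/-- Complex multiplication by `1 - i`. -/
lemma comp_one_sub_I_mul (hs : IsSineGerm s) :
    ∀ᶠ z in 𝓝 0, s ((1 - I) * z) = (1 - I) * s z / deriv s z := by
  have ha : (1 - I : ℂ) ≠ 0 := fun h => by simpa using congrArg Complex.re h
  have hd : ∀ᶠ z in 𝓝 0, HasDerivAt (fun z => (1 - I) * s z / deriv s z)
      ((1 - I) * (1 + s z ^ 4) / deriv s z ^ 2) z := by
    filter_upwards [hs.hasDerivAt, hs.hasDerivAt_deriv, hs.deriv_ne_zero, hs.deriv_sq]
      with z h1 h2 h3 h4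
    convert! (h1.const_mul (1 - I)).div h2 h3 using 1
    congr 1
    linear_combination -(1 - I) * h4
  refine hs.comp_mul_eq ha ((analyticAt_const.mul hs.analyticAt).div hs.analyticAt.deriv
    (by simp [hs.deriv_zero])) (by simp [hs.zero]) ?_ ?_
  · rw [hd.self_of_nhds.deriv, hs.zero, hs.deriv_zero]
    simp
  · filter_upwards [hd, hs.deriv_ne_zero, hs.deriv_sq] with z h1 h2 h3
    rw [h1.deriv]
    -- With this, the equation reduces to (1+s⁴)² = (1-s⁴)² + 4s⁴.
    have h4 : (1 - I) ^ 4 = -4 := by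
      linear_combination (I ^ 2 - 4 * I + 5) * I_sq
    field_simp
    rw [h4, show deriv s z ^ 4 = (deriv s z ^ 2) ^ 2 by ring, h3]
    ring

/-- The duplication formula. -/
lemma comp_two_mul (hs : IsSineGerm s) :
    ∀ᶠ z in 𝓝 0, s (2 * z) = 2 * s z * deriv s z / (1 + s z ^ 4) := by
  have hne : ∀ᶠ z in 𝓝 0, 1 + s z ^ 4 ≠ 0 :=
    (analyticAt_const.add (hs.analyticAt.pow 4)).continuousAt.eventually_ne (by simp [hs.zero])
  have hd : ∀ᶠ z in 𝓝 0, HasDerivAt (fun z => 2 * s z * deriv s z / (1 + s z ^ 4))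
      (2 * (1 - 6 * s z ^ 4 + s z ^ 8) / (1 + s z ^ 4) ^ 2) z := by
    filter_upwards [hs.hasDerivAt, hs.hasDerivAt_deriv, hne, hs.deriv_sq]
      with z h1 h2 h3 h4
    convert! ((h1.const_mul 2).mul h2).div ((h1.pow 4).const_add 1) h3 using 1
    congr 1
    simp only [Nat.cast_ofNat, Nat.add_one_sub_one, Pi.mul_apply, Pi.pow_apply]
    linear_combination (-2 * (1 + s z ^ 4) + 8 * s z ^ 4) * h4
  refine hs.comp_mul_eq two_ne_zero (((analyticAt_const.mul hs.analyticAt).mul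
    hs.analyticAt.deriv).div (analyticAt_const.add (hs.analyticAt.pow 4))
    (by simp [hs.zero])) (by simp [hs.zero]) ?_ ?_
  · rw [hd.self_of_nhds.deriv, hs.zero]
    simp
  · filter_upwards [hd, hne, hs.deriv_sq] with z h1 h2 h3
    rw [h1.deriv]
    -- With u = s⁴ the equation is (1 - 6u + u²)² = (1+u)⁴ - 16u(1-u)².
    field_simp
    rw [show deriv s z ^ 4 = (deriv s z ^ 2) ^ 2 by ring, h3]
    ring

lemma comp_conj (hs : IsSineGerm s) :
    IsSineGerm (starRingEnd ℂ ∘ s ∘ starRingEnd ℂ) where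
  analyticAt := by
    have hc : Tendsto (starRingEnd ℂ) (𝓝 0) (𝓝 0) := by
      simpa using Complex.continuous_conj.tendsto 0
    rw [analyticAt_iff_eventually_differentiableAt]
    filter_upwards [hc.eventually hs.analyticAt.eventually_analyticAt] with z hz
    exact differentiableAt_conj_conj_iff.2 hz.differentiableAt
  zero := by simp [hs.zero]
  deriv_zero := by simp [hs.deriv_zero]
  deriv_sq := by
    have hc : Tendsto (starRingEnd ℂ) (𝓝 0) (𝓝 0) := by
      simpa using Complex.continuous_conj.tendsto 0
    filter_upwards [hc.eventually hs.deriv_sq] with z hz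
    simp only [deriv_conj_conj, Function.comp_apply, ← map_pow, hz]
    simp

end IsSineGerm

/-! ### Meromorphic continuation to the plane. -/

/-- Meromorphic functions on growing discs with a common germ at `0` define a meromorphic function
on the plane. -/
lemma exists_meromorphicNFOn_of_discs {f : ℕ → ℂ → ℂ} {R : ℕ → ℝ} {s : ℂ → ℂ}
    (hR : ∀ z : ℂ, ∃ n, ‖z‖ < R n) (hpos : ∀ n, 0 < R n)
    (hf : ∀ n, MeromorphicOn (f n) (ball 0 (R n))) (hfs : ∀ n, f n =ᶠ[𝓝[≠] 0] s) :
    ∃ S : ℂ → ℂ, MeromorphicNFOn S univ ∧ S =ᶠ[𝓝[≠] 0] s := by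
  choose N hN using hR
  have hcongr : ∀ m n z, ‖z‖ < R m → ‖z‖ < R n → f m =ᶠ[𝓝[≠] z] f n := by
    intro m n z hm hn
    have hsub1 : ball (0 : ℂ) (min (R m) (R n)) ⊆ ball 0 (R m) := ball_subset_ball (min_le_left _ _)
    have hsub2 : ball (0 : ℂ) (min (R m) (R n)) ⊆ ball 0 (R n) :=
      ball_subset_ball (min_le_right _ _)
    exact eventuallyEq_nhdsNE_of_isPreconnected ((hf m).mono_set hsub1) ((hf n).mono_set hsub2)
      (convex_ball _ _).isPreconnected (mem_ball_self (lt_min (hpos m) (hpos n)))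
      (by simpa using ⟨hm, hn⟩) ((hfs m).trans (hfs n).symm)
  -- The value at z is that of the normal form of any piece defined there; pieces agree on punctured
  -- neighbourhoods, so the choice of `N z` is immaterial.
  have hS : ∀ n z, ‖z‖ < R n →
      (fun z => toMeromorphicNFAt (f (N z)) z z) =ᶠ[𝓝[≠] z] f n := by
    intro n z hz
    have hball : ball (0 : ℂ) (R n) ∈ 𝓝[≠] z :=
      mem_nhdsWithin_of_mem_nhds (isOpen_ball.mem_nhds (by simpa using hz))
    filter_upwards [(hf n z (by simpa using hz)).eventually_analyticAt, hball] with w hw hwb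
    have hw' : ‖w‖ < R n := by simpa using hwb
    have := (toMeromorphicNFAt_eventuallyEq_nhds_congr
      (hcongr (N w) n w (hN w) hw')).self_of_nhds
    rw [this, toMeromorphicNFAt_eq_self.2 hw.meromorphicNFAt]
  refine ⟨fun z => toMeromorphicNFAt (f (N z)) z z, fun z _ => ?_,
    (hS 0 0 (by simpa using hpos 0)).trans (hfs 0)⟩
  have hm : MeromorphicAt (f (N z)) z := hf (N z) z (by simpa using hN z)
  have h1 := (hS (N z) z (hN z)).trans hm.eq_nhdsNE_toMeromorphicNFAt
  rw [meromorphicNFAt_congr (eventuallyEq_nhds_of_eventuallyEq_nhdsNE h1 rfl)]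
  exact meromorphicNFAt_toMeromorphicNFAt

/-- The meromorphic continuation of the lemniscatic sine to the plane. -/
lemma exists_meromorphicNFOn_sine : ∃ S : ℂ → ℂ, MeromorphicNFOn S univ ∧ IsSineGerm S := by
  obtain ⟨s, hsa, hs0, hs1, hs2⟩ := exists_local_sine
  have hs : IsSineGerm s := ⟨hsa, hs0, hs1, hs2⟩
  have ha : (1 - I : ℂ) ≠ 0 := fun h => by simpa using congrArg Complex.re h
  have hnorm : ‖(1 - I : ℂ)⁻¹‖ = (Real.sqrt 2)⁻¹ := by
    rw [norm_inv, Complex.norm_def, normSq_apply]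
    norm_num
  have h2 : (1 : ℝ) < Real.sqrt 2 := by
    rw [Real.lt_sqrt] <;> norm_num
  obtain ⟨ε, hε, hball⟩ := Metric.eventually_nhds_iff_ball.1 hsa.eventually_analyticAt
  -- Each step reads the formula for s((1-i)w) as a definition at z = (1-i)w, enlarging the disc by
  -- the factor √2.
  let f : ℕ → ℂ → ℂ := fun n => n.rec s fun _ g z =>
    (1 - I) * g ((1 - I)⁻¹ * z) / deriv g ((1 - I)⁻¹ * z)
  have hloc : ∀ n, f n =ᶠ[𝓝 0] s := by
    intro n
    induction n with
    | zero => exact EventuallyEq.rfl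
    | succ n ih =>
      have htd := IsSineGerm.tendsto_mul (1 - I)⁻¹
      filter_upwards [htd.eventually ih, htd.eventually ih.deriv,
        htd.eventually hs.comp_one_sub_I_mul] with z h1 h2 h3
      change (1 - I) * f n ((1 - I)⁻¹ * z) / deriv (f n) ((1 - I)⁻¹ * z) = s z
      rw [h1, h2, ← h3, mul_inv_cancel_left₀ ha]
  have hmer : ∀ n, MeromorphicOn (f n) (ball 0 (Real.sqrt 2 ^ n * ε)) := by
    intro n
    induction n with
    | zero => exact fun z hz => (hball z (by simpa using hz)).meromorphicAt
    | succ n ih =>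
      intro z hz
      have hz' : (1 - I)⁻¹ * z ∈ ball (0 : ℂ) (Real.sqrt 2 ^ n * ε) := by
        rw [mem_ball_zero_iff, pow_succ] at hz
        rw [mem_ball_zero_iff, norm_mul, hnorm, inv_mul_lt_iff₀ (by positivity)]
        linarith
      have hm : AnalyticAt ℂ (fun z : ℂ => (1 - I)⁻¹ * z) z := by fun_prop
      exact ((MeromorphicAt.const _ _).mul ((ih _ hz').comp_analyticAt hm)).div
        ((ih _ hz').deriv.comp_analyticAt hm)
  obtain ⟨S, hS, hSs⟩ := exists_meromorphicNFOn_of_discs (s := s) (f := f)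
    (R := fun n => Real.sqrt 2 ^ n * ε)
    (fun z => by
      obtain ⟨n, hn⟩ := pow_unbounded_of_one_lt (‖z‖ / ε) h2
      exact ⟨n, by rwa [div_lt_iff₀ hε] at hn⟩)
    (fun n => by positivity) hmer (fun n => (hloc n).filter_mono nhdsWithin_le_nhds)
  have hSs' : S =ᶠ[𝓝 0] s :=
    ((hS (mem_univ 0)).eventuallyEq_nhdsNE_iff_eventuallyEq_nhds hsa.meromorphicNFAt).1 hSs
  refine ⟨S, hS, hsa.congr hSs'.symm, hSs'.self_of_nhds.trans hs0, hSs'.deriv_eq.trans hs1, ?_⟩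
  filter_upwards [hSs', hSs'.deriv, hs2] with z h1 h2 h3
  rw [h1, h2, h3]

/-! ### The global function and its differential equation. -/

/-- A meromorphic function in normal form whose germ at `0` is that of the lemniscatic sine. -/
structure IsSine (S : ℂ → ℂ) : Prop where
  nf : MeromorphicNFOn S univ
  germ : IsSineGerm S

lemma one_sub_I_ne_zero : (1 - I : ℂ) ≠ 0 := fun h => by simpa using congrArg Complex.re h

lemma r_pos : 0 < r := by unfold r; positivity

lemma sqrt_two_mul_r : Real.sqrt 2 * r = 1 := by
  unfold r; field_simp

lemma two_mul_r : 2 * r = Real.sqrt 2 := by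
  have h := Real.mul_self_sqrt (show (0 : ℝ) ≤ 2 by norm_num)
  have h2 := sqrt_two_mul_r
  linear_combination (-r) * h + Real.sqrt 2 * h2

lemma meromorphic_comp_mul {f : ℂ → ℂ} (hf : Meromorphic f) (a : ℂ) :
    Meromorphic fun z => f (a * z) :=
  fun z => (hf (a * z)).comp_analyticAt (g := fun z => a * z) (by fun_prop)

lemma meromorphicNFOn_comp_affine {f : ℂ → ℂ} (hf : MeromorphicNFOn f univ) (a b : ℂ) :
    MeromorphicNFOn (fun z => f (a * z + b)) univ :=
  fun z _ => (hf (mem_univ (a * z + b))).comp_analyticAt (g := fun z => a * z + b) (by fun_prop)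

lemma eq_of_eventuallyEq_nhdsNE {f g : ℂ → ℂ} {z : ℂ} (h : f =ᶠ[𝓝[≠] z] g)
    (hf : ContinuousAt f z) (hg : ContinuousAt g z) : f z = g z :=
  ((hf.eventuallyEq_nhds_iff_eventuallyEq_nhdsNE hg).1 h).self_of_nhds

namespace IsSine

variable {S : ℂ → ℂ}

lemma meromorphic (hS : IsSine S) : Meromorphic S := fun z => (hS.nf (mem_univ z)).meromorphicAt

lemma meromorphic_deriv (hS : IsSine S) : Meromorphic (deriv S) := hS.meromorphic.deriv

lemma map_zero (hS : IsSine S) : S 0 = 0 := hS.germ.zero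

lemma analyticAt_of_order_nonneg (hS : IsSine S) {z : ℂ} (h : 0 ≤ meromorphicOrderAt S z) :
    AnalyticAt ℂ S z :=
  (hS.nf (mem_univ z)).meromorphicOrderAt_nonneg_iff_analyticAt.1 h

lemma order_neg (hS : IsSine S) {z : ℂ} (h : ¬ AnalyticAt ℂ S z) : meromorphicOrderAt S z < 0 := by
  by_contra h2
  exact h (hS.analyticAt_of_order_nonneg (not_lt.1 h2))

/-- Normal form assigns 0 at poles, so a nonzero value certifies analyticity. -/
lemma analyticAt_of_ne_zero (hS : IsSine S) {z : ℂ} (h : S z ≠ 0) : AnalyticAt ℂ S z :=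
  hS.analyticAt_of_order_nonneg ((hS.nf (mem_univ z)).meromorphicOrderAt_eq_zero_iff.2 h).ge

lemma eq_zero_of_not_analyticAt (hS : IsSine S) {z : ℂ} (h : ¬ AnalyticAt ℂ S z) : S z = 0 := by
  by_contra h2
  exact h (hS.analyticAt_of_ne_zero h2)

/-- A function in normal form agreeing off `z` with a function analytic at `z`. -/
lemma analyticAt_comp_mul_of_eventuallyEq (hS : IsSine S) {a z : ℂ} (ha : a ≠ 0) {g : ℂ → ℂ}
    (hg : AnalyticAt ℂ g z) (h : (fun w => S (a * w)) =ᶠ[𝓝[≠] z] g) :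
    AnalyticAt ℂ S (a * z) ∧ S (a * z) = g z := by
  have hnf : MeromorphicNFAt (fun w => S (a * w)) z := by
    simpa using meromorphicNFOn_comp_affine hS.nf a 0 (mem_univ z)
  have h2 := (hnf.eventuallyEq_nhdsNE_iff_eventuallyEq_nhds hg.meromorphicNFAt).1 h
  refine ⟨?_, h2.self_of_nhds⟩
  have h3 : AnalyticAt ℂ (S ∘ fun w => a * w) z := hg.congr h2.symm
  rwa [analyticAt_comp_iff_of_deriv_ne_zero (by fun_prop) (by simpa using ha)] at h3

lemma eventually_deriv_sq (hS : IsSine S) (z : ℂ) :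
    ∀ᶠ w in 𝓝[≠] z, deriv S w ^ 2 = 1 - S w ^ 4 :=
  eventuallyEq_nhdsNE_of_meromorphic (hS.meromorphic_deriv.pow (n := 2))
    ((Meromorphic.const 1).sub (hS.meromorphic.pow (n := 4))) (x := 0)
    (hS.germ.deriv_sq.filter_mono nhdsWithin_le_nhds) z

lemma deriv_sq (hS : IsSine S) {z : ℂ} (hz : AnalyticAt ℂ S z) : deriv S z ^ 2 = 1 - S z ^ 4 :=
  eq_of_eventuallyEq_nhdsNE (f := fun z => deriv S z ^ 2) (g := fun z => 1 - S z ^ 4)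
    (hS.eventually_deriv_sq z) (hz.deriv.pow 2).continuousAt
    (analyticAt_const.sub (hz.pow 4)).continuousAt

lemma deriv_deriv (hS : IsSine S) {z : ℂ} (hz : AnalyticAt ℂ S z) :
    deriv (deriv S) z = -2 * S z ^ 3 := by
  have h : ∀ᶠ w in 𝓝[≠] (0 : ℂ), deriv (deriv S) w = -2 * S w ^ 3 :=
    (hS.germ.hasDerivAt_deriv.mono fun w hw => hw.deriv).filter_mono nhdsWithin_le_nhds
  exact eq_of_eventuallyEq_nhdsNE (f := deriv (deriv S)) (g := fun w => -2 * S w ^ 3)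
    (eventuallyEq_nhdsNE_of_meromorphic hS.meromorphic_deriv.deriv
      ((Meromorphic.const (-2)).mul (hS.meromorphic.pow (n := 3))) (x := 0) h z)
    hz.deriv.deriv.continuousAt (analyticAt_const.mul (hz.pow 3)).continuousAt

lemma hasDerivAt_deriv (hS : IsSine S) {z : ℂ} (hz : AnalyticAt ℂ S z) :
    HasDerivAt (deriv S) (-2 * S z ^ 3) z :=
  hS.deriv_deriv hz ▸ hz.deriv.differentiableAt.hasDerivAt

/-! ### Symmetries -/

/-- Both sides are in normal form, so the identity of germs at 0 extends to every point, poles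
included. -/
lemma map_I_mul (hS : IsSine S) (z : ℂ) : S (I * z) = I * S z := by
  have h1 : MeromorphicNFOn (fun z => S (I * z)) univ := by
    simpa using meromorphicNFOn_comp_affine hS.nf I 0
  have h2 : MeromorphicNFOn (fun z => I * S z) univ := fun z hz =>
    (meromorphicNFAt_mul_iff_right (g := fun _ => I) analyticAt_const I_ne_zero).2 (hS.nf hz)
  exact congrFun (eq_of_meromorphicNFOn h1 h2 (x := 0)
    (hS.germ.comp_I_mul.filter_mono nhdsWithin_le_nhds)) z

lemma map_neg (hS : IsSine S) (z : ℂ) : S (-z) = -S z := by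
  have : -z = I * (I * z) := by rw [← mul_assoc, I_mul_I]; ring
  rw [this, hS.map_I_mul, hS.map_I_mul, ← mul_assoc, I_mul_I]
  ring

lemma deriv_I_mul (hS : IsSine S) (z : ℂ) : deriv S (I * z) = deriv S z := by
  have h : (fun z => S (I * z)) = fun z => I * S z := funext hS.map_I_mul
  have h2 := congrFun (congrArg deriv h) z
  rw [IsSineGerm.deriv_comp_mul, deriv_const_mul_field] at h2
  exact mul_left_cancel₀ I_ne_zero h2

lemma deriv_neg (hS : IsSine S) (z : ℂ) : deriv S (-z) = deriv S z := by
  have : -z = I * (I * z) := by rw [← mul_assoc, I_mul_I]; ring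
  rw [this, hS.deriv_I_mul, hS.deriv_I_mul]

lemma map_conj (hS : IsSine S) (z : ℂ) : S (starRingEnd ℂ z) = starRingEnd ℂ (S z) := by
  have hc : ∀ z, Tendsto (starRingEnd ℂ) (𝓝 z) (𝓝 (starRingEnd ℂ z)) :=
    Complex.continuous_conj.tendsto
  have hconj : ∀ {g : ℂ → ℂ} {z}, AnalyticAt ℂ g (starRingEnd ℂ z) →
      AnalyticAt ℂ (starRingEnd ℂ ∘ g ∘ starRingEnd ℂ) z := by
    intro g z hg
    rw [analyticAt_iff_eventually_differentiableAt]
    filter_upwards [(hc z).eventually hg.eventually_analyticAt] with w hw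
    exact differentiableAt_conj_conj_iff.2 hw.differentiableAt
  have h1 : MeromorphicNFOn (starRingEnd ℂ ∘ S ∘ starRingEnd ℂ) univ := by
    intro z _
    rcases hS.nf (mem_univ (starRingEnd ℂ z)) with h | ⟨n, g, hg, hg0, h⟩
    · left
      filter_upwards [(hc z).eventually h] with w hw
      simp [hw]
    · right
      refine ⟨n, _, hconj hg, by simpa using hg0, ?_⟩
      filter_upwards [(hc z).eventually h] with w hw
      simp [hw]
  have h2 := congrFun (eq_of_meromorphicNFOn h1 hS.nf (x := 0)
    ((hS.germ.comp_conj.eventuallyEq hS.germ).filter_mono nhdsWithin_le_nhds)) z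
  rw [← h2]
  simp

/-! ### Duplication and complex multiplication -/

/-- Cleared of denominators, so that it stays usable around zeros of 1 + S⁴. -/
lemma eventually_map_two_mul (hS : IsSine S) (z : ℂ) :
    ∀ᶠ w in 𝓝[≠] z, S (2 * w) * (1 + S w ^ 4) = 2 * S w * deriv S w := by
  have hne : ∀ᶠ z in 𝓝 0, 1 + S z ^ 4 ≠ 0 :=
    (analyticAt_const.add (hS.germ.analyticAt.pow 4)).continuousAt.eventually_ne
      (by simp [hS.map_zero])
  refine eventuallyEq_nhdsNE_of_meromorphic ((meromorphic_comp_mul hS.meromorphic 2).mul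
    ((Meromorphic.const 1).add (hS.meromorphic.pow (n := 4))))
    (((Meromorphic.const 2).mul hS.meromorphic).mul hS.meromorphic_deriv) (x := 0) ?_ z
  refine Eventually.filter_mono nhdsWithin_le_nhds ?_
  filter_upwards [hS.germ.comp_two_mul, hne] with w h1 h2
  simp only [Pi.mul_apply, Pi.add_apply, Pi.pow_apply, h1]
  field_simp

lemma map_two_mul (hS : IsSine S) {z : ℂ} (hz : AnalyticAt ℂ S z) (h : 1 + S z ^ 4 ≠ 0) :
    AnalyticAt ℂ S (2 * z) ∧ S (2 * z) = 2 * S z * deriv S z / (1 + S z ^ 4) := by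
  have ha : AnalyticAt ℂ (fun z => 1 + S z ^ 4) z := analyticAt_const.add (hz.pow 4)
  refine hS.analyticAt_comp_mul_of_eventuallyEq two_ne_zero
    (((analyticAt_const.mul hz).mul hz.deriv).div ha h) ?_
  filter_upwards [hS.eventually_map_two_mul z,
    (ha.continuousAt.eventually_ne h).filter_mono nhdsWithin_le_nhds] with w h1 h2
  simp only [Pi.mul_apply, Pi.div_apply]
  rw [← h1]
  field_simp

/-- Analyticity at 2z would give S S' = 0 at z by the cleared formula, but S⁴ = -1 makes S nonzero
and S'² = 2. -/
lemma not_analyticAt_two_mul (hS : IsSine S) {z : ℂ} (hz : AnalyticAt ℂ S z)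
    (h : 1 + S z ^ 4 = 0) : ¬ AnalyticAt ℂ S (2 * z) := by
  intro ha
  have hc : ContinuousAt (fun w => S (2 * w)) z :=
    ContinuousAt.comp' (g := S) (f := fun w => 2 * w) ha.continuousAt (by fun_prop)
  have h1 := eq_of_eventuallyEq_nhdsNE (f := fun w => S (2 * w) * (1 + S w ^ 4))
    (g := fun w => 2 * S w * deriv S w) (hS.eventually_map_two_mul z)
    (hc.mul (analyticAt_const.add (hz.pow 4)).continuousAt)
    ((analyticAt_const.mul hz).mul hz.deriv).continuousAt
  simp only [h, mul_zero] at h1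
  have h2 := hS.deriv_sq hz
  have h3 : (2 * S z * deriv S z) ^ 2 = 0 := by rw [← h1]; ring
  have h4 : (S z ^ 2 : ℂ) = 0 := by
    linear_combination (1 / 8) * h3 - (1 / 2) * S z ^ 2 * h2 + (1 / 2) * S z ^ 2 * h
  rw [show S z ^ 4 = (S z ^ 2) ^ 2 by ring, h4] at h
  norm_num at h

lemma eventually_map_one_sub_I_mul (hS : IsSine S) (z : ℂ) :
    ∀ᶠ w in 𝓝[≠] z, S ((1 - I) * w) * deriv S w = (1 - I) * S w := by
  refine eventuallyEq_nhdsNE_of_meromorphic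
    ((meromorphic_comp_mul hS.meromorphic (1 - I)).mul hS.meromorphic_deriv)
    ((Meromorphic.const (1 - I)).mul hS.meromorphic) (x := 0) ?_ z
  refine Eventually.filter_mono nhdsWithin_le_nhds ?_
  filter_upwards [hS.germ.comp_one_sub_I_mul, hS.germ.deriv_ne_zero] with w h1 h2
  simp only [Pi.mul_apply, h1]
  field_simp

lemma map_one_sub_I_mul_mul_deriv (hS : IsSine S) {z : ℂ} (hz : AnalyticAt ℂ S z)
    (ha : AnalyticAt ℂ S ((1 - I) * z)) : S ((1 - I) * z) * deriv S z = (1 - I) * S z := by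
  have hc : ContinuousAt (fun w => S ((1 - I) * w)) z :=
    ContinuousAt.comp' (g := S) (f := fun w => (1 - I) * w) ha.continuousAt (by fun_prop)
  exact eq_of_eventuallyEq_nhdsNE (f := fun w => S ((1 - I) * w) * deriv S w)
    (g := fun w => (1 - I) * S w) (hS.eventually_map_one_sub_I_mul z)
    (hc.mul hz.deriv.continuousAt) (analyticAt_const.mul hz).continuousAt

lemma map_one_sub_I_mul (hS : IsSine S) {z : ℂ} (hz : AnalyticAt ℂ S z) (h : 1 - S z ^ 4 ≠ 0) :
    AnalyticAt ℂ S ((1 - I) * z) ∧ S ((1 - I) * z) = (1 - I) * S z / deriv S z := by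
  have h' : deriv S z ≠ 0 := fun h0 => h (by rw [← hS.deriv_sq hz, h0]; ring)
  refine hS.analyticAt_comp_mul_of_eventuallyEq one_sub_I_ne_zero
    ((analyticAt_const.mul hz).div hz.deriv h') ?_
  filter_upwards [hS.eventually_map_one_sub_I_mul z,
    (hz.deriv.continuousAt.eventually_ne h').filter_mono nhdsWithin_le_nhds] with w h1 h2
  simp only [Pi.mul_apply, Pi.div_apply]
  rw [← h1]
  field_simp

/-- Here S' = 0 at z, so the cleared formula would force S z = 0, against S⁴ = 1. -/
lemma not_analyticAt_one_sub_I_mul (hS : IsSine S) {z : ℂ} (hz : AnalyticAt ℂ S z)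
    (h : 1 - S z ^ 4 = 0) : ¬ AnalyticAt ℂ S ((1 - I) * z) := by
  intro ha
  have h1 := hS.map_one_sub_I_mul_mul_deriv hz ha
  have h2 : deriv S z = 0 := by
    have := hS.deriv_sq hz
    rwa [h, sq_eq_zero_iff] at this
  rw [h2, mul_zero, eq_comm, mul_eq_zero, or_iff_right one_sub_I_ne_zero] at h1
  rw [h1] at h
  norm_num at h

/-! ### Behaviour near the origin -/

lemma norm_deriv_le (hS : IsSine S) {z : ℂ} (hz : AnalyticAt ℂ S z) (h : ‖S z‖ ≤ 1) :
    ‖deriv S z‖ ≤ Real.sqrt 2 := by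
  apply Real.le_sqrt_of_sq_le
  rw [← norm_pow, hS.deriv_sq hz]
  refine (norm_sub_le _ _).trans ?_
  rw [norm_one, norm_pow]
  have := pow_le_one₀ (n := 4) (norm_nonneg _) h
  linarith

/-- Continuity argument along the segment from 0 to z. While |S| ≤ 1 one has |S'| ≤ √2, and the mean
value inequality then keeps |S| ≤ √2|z| < 1, because r = 1/√2. -/
lemma analyticAt_and_norm_le (hS : IsSine S) {z : ℂ} (hz : ‖z‖ < r) :
    AnalyticAt ℂ S z ∧ ‖S z‖ ≤ Real.sqrt 2 * ‖z‖ := by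
  rcases eq_or_ne z 0 with rfl | hz0
  · exact ⟨hS.germ.analyticAt, by simp [hS.map_zero]⟩
  set s : Set ℝ := {t | AnalyticAt ℂ S (t * z) ∧ ‖S (t * z)‖ ≤ Real.sqrt 2 * (t * ‖z‖)} with hs
  have hcont : Continuous fun t : ℝ => (t : ℂ) * z := by fun_prop
  have hclosed : IsClosed s := by
    rw [← isOpen_compl_iff, isOpen_iff_mem_nhds]
    intro t ht
    by_cases ha : AnalyticAt ℂ S (t * z)
    · have hlt : Real.sqrt 2 * (t * ‖z‖) < ‖S (t * z)‖ := by
        by_contra h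
        exact ht ⟨ha, not_lt.1 h⟩
      have hc : ContinuousAt (fun t : ℝ => ‖S (t * z)‖) t :=
        (ContinuousAt.comp' (g := S) (f := fun t : ℝ => (t : ℂ) * z) ha.continuousAt
          hcont.continuousAt).norm
      have hc2 : ContinuousAt (fun t : ℝ => Real.sqrt 2 * (t * ‖z‖)) t := by fun_prop
      filter_upwards [hc2.eventually_lt hc hlt] with τ hτ hτs
      exact absurd hτs.2 (not_le.2 hτ)
    -- At a pole the norm blows up, so the bound fails nearby: the segment cannot run into a pole.
    · have htend := tendsto_norm_atTop_iff_cobounded.2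
        (tendsto_cobounded_of_meromorphicOrderAt_neg (hS.order_neg ha))
      have hmap : Tendsto (fun t : ℝ => (t : ℂ) * z) (𝓝[≠] t) (𝓝[≠] (t * z)) := by
        refine tendsto_nhdsWithin_of_tendsto_nhds_of_eventually_within _
          (hcont.continuousAt.tendsto.mono_left nhdsWithin_le_nhds) ?_
        filter_upwards [self_mem_nhdsWithin] with τ hτ h
        exact hτ (by simpa using mul_right_cancel₀ hz0 h)
      have h1 : ∀ᶠ τ in 𝓝[≠] t, τ ∈ sᶜ := by
        filter_upwards [(htend.comp hmap).eventually_gt_atTop (Real.sqrt 2 * ((t + 1) * ‖z‖)),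
          mem_nhdsWithin_of_mem_nhds (Iio_mem_nhds (lt_add_one t))] with τ h1 h2 h3
        have h4 : Real.sqrt 2 * (τ * ‖z‖) ≤ Real.sqrt 2 * ((t + 1) * ‖z‖) := by
          have : τ ≤ t + 1 := le_of_lt h2
          gcongr
        exact absurd (h3.2.trans h4) (not_le.2 h1)
      rw [eventually_nhdsWithin_iff] at h1
      filter_upwards [h1] with τ hτ
      rcases eq_or_ne τ t with rfl | hne
      · exact ht
      · exact hτ hne
  have hsub : Icc (0 : ℝ) 1 ⊆ s := by
    refine (hclosed.inter isClosed_Icc).Icc_subset_of_forall_mem_nhdsWithin ?_ ?_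
    · simp [hs, hS.map_zero, hS.germ.analyticAt]
    · rintro x ⟨⟨hxa, hxb⟩, hx0, hx1⟩
      have hlt : ‖S (x * z)‖ < 1 := by
        refine hxb.trans_lt ?_
        have hsq : 0 < Real.sqrt 2 := by positivity
        rw [← sqrt_two_mul_r]
        refine (mul_lt_mul_iff_right₀ hsq).2 (lt_of_le_of_lt ?_ hz)
        nlinarith [norm_nonneg z]
      have hev : ∀ᶠ w in 𝓝 (x * z : ℂ), AnalyticAt ℂ S w ∧ ‖S w‖ < 1 :=
        hxa.eventually_analyticAt.and
          (hxa.continuousAt.norm.eventually_lt continuousAt_const hlt)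
      obtain ⟨δ, hδ, hball⟩ := Metric.eventually_nhds_iff_ball.1 hev
      filter_upwards [self_mem_nhdsWithin, mem_nhdsWithin_of_mem_nhds
        (hcont.continuousAt.preimage_mem_nhds (ball_mem_nhds _ hδ))] with τ hτx hτ
      refine ⟨(hball _ hτ).1, ?_⟩
      have hmv := (convex_ball (x * z : ℂ) δ).norm_image_sub_le_of_norm_deriv_le
        (f := S) (C := Real.sqrt 2) (fun w hw => (hball w hw).1.differentiableAt)
        (fun w hw => hS.norm_deriv_le (hball w hw).1 (hball w hw).2.le) (mem_ball_self hδ) hτ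
      rw [← sub_mul, ← ofReal_sub, norm_mul, norm_real, Real.norm_of_nonneg
        (sub_nonneg.2 (le_of_lt hτx))] at hmv
      have := norm_sub_norm_le (S (τ * z)) (S (x * z))
      linarith
  simpa [hs] using hsub (right_mem_Icc.2 zero_le_one)

lemma analyticAt_of_norm_lt_r (hS : IsSine S) {z : ℂ} (hz : ‖z‖ < r) : AnalyticAt ℂ S z :=
  (hS.analyticAt_and_norm_le hz).1

lemma norm_lt_one (hS : IsSine S) {z : ℂ} (hz : ‖z‖ < r) : ‖S z‖ < 1 := by
  refine (hS.analyticAt_and_norm_le hz).2.trans_lt ?_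
  rw [← sqrt_two_mul_r]
  have hsq : 0 < Real.sqrt 2 := by positivity
  exact (mul_lt_mul_iff_right₀ hsq).2 hz

lemma re_one_sub_pos {z : ℂ} (h : ‖z‖ < 1) : 0 < (1 - z ^ 4).re := by
  have h1 : ‖z ^ 4‖ < 1 := by
    rw [norm_pow]
    exact pow_lt_one₀ (norm_nonneg _) h (by norm_num)
  have h2 := (abs_le.1 (abs_re_le_norm (z ^ 4))).2
  simp only [sub_re, one_re]
  linarith

lemma one_add_pow_ne_zero {z : ℂ} (h : ‖z‖ < 1) {n : ℕ} (hn : n ≠ 0) : 1 + z ^ n ≠ 0 := by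
  intro h0
  have h1 : ‖z ^ n‖ = 1 := by rw [eq_neg_of_add_eq_zero_right h0]; simp
  rw [norm_pow] at h1
  exact (pow_lt_one₀ (norm_nonneg _) h hn).ne h1

/-- Two continuous square roots of a nonvanishing function on a connected disc, equal at 0. -/
lemma deriv_eq_cpow (hS : IsSine S) {z : ℂ} (hz : ‖z‖ < r) :
    deriv S z = (1 - S z ^ 4) ^ (1 / 2 : ℂ) := by
  have han : ∀ w ∈ ball (0 : ℂ) r, AnalyticAt ℂ S w := fun w hw =>
    hS.analyticAt_of_norm_lt_r (by simpa using hw)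
  have hslit : ∀ w ∈ ball (0 : ℂ) r, 1 - S w ^ 4 ∈ slitPlane := fun w hw =>
    Or.inl (re_one_sub_pos (hS.norm_lt_one (by simpa using hw)))
  refine (convex_ball (0 : ℂ) r).isPreconnected.eq_of_sq_eq (f := deriv S)
    (g := fun w => (1 - S w ^ 4) ^ (1 / 2 : ℂ)) (y := 0)
    (fun w hw => (han w hw).deriv.continuousAt.continuousWithinAt) (fun w hw => ?_)
    (fun w hw => ?_) (fun {w} hw => ?_) (mem_ball_self r_pos) ?_ (by simpa using hz)
  · exact ((analyticAt_const.sub ((han w hw).pow 4)).continuousAt.cpow continuousAt_const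
      (hslit w hw)).continuousWithinAt
  · simp only [Pi.pow_apply, hS.deriv_sq (han w hw), cpow_half_sq]
  · simp only [ne_eq, cpow_eq_zero_iff, not_and_or]
    exact Or.inl (slitPlane_ne_zero (hslit w hw))
  · simp [hS.germ.deriv_zero, hS.map_zero]

/-- From (S'-1)(S'+1) = -S⁴, where Re S' ≥ 0 because S' is a principal root. -/
lemma norm_deriv_sub_one_le (hS : IsSine S) {z : ℂ} (hz : ‖z‖ < r) :
    ‖deriv S z - 1‖ ≤ ‖S z‖ ^ 4 := by
  have h1 : (deriv S z - 1) * (deriv S z + 1) = -(S z ^ 4) := by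
    linear_combination hS.deriv_sq (hS.analyticAt_of_norm_lt_r hz)
  have h2 : 1 ≤ ‖deriv S z + 1‖ := by
    refine le_trans ?_ (re_le_norm _)
    rw [hS.deriv_eq_cpow hz, add_re, one_re, one_div, cpow_inv_two_re]
    linarith [Real.sqrt_nonneg ((‖1 - S z ^ 4‖ + (1 - S z ^ 4).re) / 2)]
  have h3 := congrArg norm h1
  rw [norm_mul, norm_neg, norm_pow] at h3
  rw [← h3]
  exact le_mul_of_one_le_right (norm_nonneg _) h2

/-- Mean value inequality for S - id. It excludes nonzero zeros and gives positivity on the positive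
real axis. -/
lemma norm_sub_self_lt (hS : IsSine S) {z : ℂ} (hz : ‖z‖ < r) (hz0 : z ≠ 0) :
    ‖S z - z‖ < ‖z‖ := by
  have hC : (Real.sqrt 2 * ‖z‖) ^ 4 < 1 := by
    refine pow_lt_one₀ (by positivity) ?_ (by norm_num)
    rw [← sqrt_two_mul_r]
    have hsq : 0 < Real.sqrt 2 := by positivity
    exact (mul_lt_mul_iff_right₀ hsq).2 hz
  have hlt : ∀ w ∈ closedBall (0 : ℂ) ‖z‖, ‖w‖ < r := fun w hw =>
    lt_of_le_of_lt (by simpa using hw) hz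
  have hmv := (convex_closedBall (0 : ℂ) ‖z‖).norm_image_sub_le_of_norm_hasDerivWithin_le
    (f := fun w => S w - w) (f' := fun w => deriv S w - 1) (C := (Real.sqrt 2 * ‖z‖) ^ 4)
    (x := 0) (y := z)
    (fun w hw => ((hS.analyticAt_of_norm_lt_r (hlt w hw)).differentiableAt.hasDerivAt.sub
      (hasDerivAt_id w)).hasDerivWithinAt)
    (fun w hw => (hS.norm_deriv_sub_one_le (hlt w hw)).trans (by
      have h1 : ‖S w‖ ≤ Real.sqrt 2 * ‖z‖ :=
        (hS.analyticAt_and_norm_le (hlt w hw)).2.trans (by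
          have : ‖w‖ ≤ ‖z‖ := by simpa using hw
          gcongr)
      gcongr)) (by simp) (by simp)
  simp only [hS.map_zero, sub_zero] at hmv
  have : 0 < ‖z‖ := norm_pos_iff.2 hz0
  nlinarith

lemma eq_zero_of_norm_lt_r (hS : IsSine S) {z : ℂ} (hz : ‖z‖ < r) (h : S z = 0) : z = 0 := by
  by_contra hz0
  simpa [h] using hS.norm_sub_self_lt hz hz0

lemma norm_half_lt {z : ℂ} (hz : ‖z‖ < Real.sqrt 2) : ‖z / 2‖ < r := by
  rw [norm_div, Complex.norm_ofNat, div_lt_iff₀ two_pos]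
  linarith [two_mul_r]

lemma analyticAt_of_norm_lt_sqrt_two (hS : IsSine S) {z : ℂ} (hz : ‖z‖ < Real.sqrt 2) :
    AnalyticAt ℂ S z ∧
      S z = 2 * S (z / 2) * deriv S (z / 2) / (1 + S (z / 2) ^ 4) := by
  have h := hS.map_two_mul (hS.analyticAt_of_norm_lt_r (norm_half_lt hz))
    (one_add_pow_ne_zero (hS.norm_lt_one (norm_half_lt hz)) (by norm_num))
  rwa [mul_div_cancel₀ z two_ne_zero] at h

lemma eq_zero_of_norm_lt_sqrt_two (hS : IsSine S) {z : ℂ} (hz : ‖z‖ < Real.sqrt 2)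
    (h : S z = 0) : z = 0 := by
  have hr := norm_half_lt hz
  have h1 := one_add_pow_ne_zero (hS.norm_lt_one hr) (n := 4) (by norm_num)
  rw [(hS.analyticAt_of_norm_lt_sqrt_two hz).2, div_eq_zero_iff, or_iff_left h1, mul_eq_zero,
    mul_eq_zero, or_iff_right two_ne_zero] at h
  rcases h with h | h
  · simpa using hS.eq_zero_of_norm_lt_r hr h
  · have h2 := hS.deriv_sq (hS.analyticAt_of_norm_lt_r hr)
    have h3 := re_one_sub_pos (hS.norm_lt_one hr)
    rw [← h2, h] at h3
    simp at h3

lemma norm_one_sub_I : ‖(1 - I : ℂ)‖ = Real.sqrt 2 := by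
  rw [Complex.norm_def, normSq_apply]
  norm_num

/-- Multiplication by 1-i gains a last factor √2. Analyticity has to be assumed: there are poles in
this disc, at distance 2K from 0, and S takes the value 0 there too. -/
lemma eq_zero_of_norm_lt_two (hS : IsSine S) {z : ℂ} (hz : ‖z‖ < 2) (ha : AnalyticAt ℂ S z)
    (h : S z = 0) : z = 0 := by
  have hw : ‖z / (1 - I)‖ < Real.sqrt 2 := by
    rw [norm_div, norm_one_sub_I, div_lt_iff₀ (by positivity),
      Real.mul_self_sqrt (by norm_num)]
    exact hz
  have hz' : (1 - I) * (z / (1 - I)) = z := mul_div_cancel₀ z one_sub_I_ne_zero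
  have h1 := hS.map_one_sub_I_mul_mul_deriv (hS.analyticAt_of_norm_lt_sqrt_two hw).1
    (by rwa [hz'])
  rw [hz', h, zero_mul, eq_comm, mul_eq_zero, or_iff_right one_sub_I_ne_zero] at h1
  have h2 := hS.eq_zero_of_norm_lt_sqrt_two hw h1
  rw [← hz', h2, mul_zero]

end IsSine

/-! ### The constants γ, K and L. -/

lemma sqrt_two_sq : (Real.sqrt 2 : ℂ) ^ 2 = 2 := by
  rw [← ofReal_pow, Real.sq_sqrt (by norm_num)]; norm_num

lemma sqrt_two_ne_zero : (Real.sqrt 2 : ℂ) ≠ 0 := by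
  rw [ofReal_ne_zero]; positivity

lemma γ_sq : γ ^ 2 = I := by
  unfold γ
  rw [div_pow, sqrt_two_sq]
  linear_combination (1 / 2) * I_sq

lemma conj_γ : starRingEnd ℂ γ = -(I * γ) := by
  unfold γ
  simp only [map_div₀, map_add, map_one, conj_I, conj_ofReal]
  have := sqrt_two_ne_zero
  field_simp
  linear_combination I_sq

lemma conj_γ_mul : starRingEnd ℂ γ * γ = 1 := by
  rw [conj_γ]
  linear_combination (-I) * γ_sq - I_sq

lemma norm_γ : ‖γ‖ = 1 := by
  have h := conj_γ_mul
  rw [mul_comm, mul_conj, normSq_eq_norm_sq] at h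
  have h2 : ‖γ‖ ^ 2 = 1 := by exact_mod_cast h
  exact (pow_eq_one_iff_of_nonneg (norm_nonneg _) two_ne_zero).1 h2

lemma sqrt_two_mul_γ : (Real.sqrt 2 : ℂ) * γ = 1 + I := by
  unfold γ
  rw [mul_div_cancel₀ _ sqrt_two_ne_zero]

lemma sqrt_two_mul_conj_γ : (Real.sqrt 2 : ℂ) * starRingEnd ℂ γ = 1 - I := by
  rw [conj_γ]
  linear_combination (-I) * sqrt_two_mul_γ - I_sq

/-- The slope exceeds 1 once ρ > 0, so ρ(1) > 1; then the intermediate value theorem and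
monotonicity apply. -/
lemma exists_unique_eq_one {ρ : ℝ → ℝ}
    (hρ : ∀ x ∈ Icc (0 : ℝ) 1, HasDerivAt ρ (Real.sqrt (1 + ρ x ^ 4)) x) (h0 : ρ 0 = 0) :
    ∃ K ∈ Ioo (0 : ℝ) 1, ρ K = 1 ∧ ∀ K' ∈ Ioo (0 : ℝ) 1, ρ K' = 1 → K' = K := by
  have hc : ContinuousOn ρ (Icc 0 1) := fun x hx => (hρ x hx).continuousAt.continuousWithinAt
  have hmono : StrictMonoOn ρ (Icc 0 1) := by
    refine strictMonoOn_of_deriv_pos (convex_Icc 0 1) hc fun x hx => ?_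
    rw [(hρ x (interior_subset hx)).deriv]
    positivity
  have hmono2 : StrictMonoOn (fun x => ρ x - x) (Icc 0 1) := by
    refine strictMonoOn_of_deriv_pos (convex_Icc 0 1) (hc.sub continuousOn_id) fun x hx => ?_
    have hx' := interior_subset hx
    have hd : HasDerivAt (fun x => ρ x - x) (Real.sqrt (1 + ρ x ^ 4) - 1) x :=
      (hρ x hx').sub (hasDerivAt_id x)
    rw [hd.deriv]
    rw [interior_Icc] at hx
    have hpos : 0 < ρ x := h0 ▸ hmono (left_mem_Icc.2 zero_le_one) hx' hx.1
    rw [sub_pos, Real.lt_sqrt (by norm_num)]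
    have : 0 < ρ x ^ 4 := by positivity
    linarith
  have h1 := hmono2 (left_mem_Icc.2 zero_le_one) (right_mem_Icc.2 zero_le_one) zero_lt_one
  simp only [h0] at h1
  obtain ⟨K, hK, hK1⟩ := intermediate_value_Ioo zero_le_one hc
    (show (1 : ℝ) ∈ Ioo (ρ 0) (ρ 1) by rw [h0]; constructor <;> linarith)
  exact ⟨K, hK, hK1, fun K' hK' h => hmono.injOn (Ioo_subset_Icc_self hK')
    (Ioo_subset_Icc_self hK) (h.trans hK1.symm)⟩

namespace IsSine

variable {S : ℂ → ℂ}

lemma deriv_conj (hS : IsSine S) (z : ℂ) :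
    deriv S (starRingEnd ℂ z) = starRingEnd ℂ (deriv S z) := by
  have h : starRingEnd ℂ ∘ S ∘ starRingEnd ℂ = S := by
    funext w
    simp [hS.map_conj]
  have h2 := congrFun (congrArg deriv h) (starRingEnd ℂ z)
  rw [deriv_conj_conj] at h2
  simpa using h2.symm

lemma ofReal_re_map (hS : IsSine S) (x : ℝ) : ((S x).re : ℂ) = S x := by
  rw [← conj_eq_iff_re, ← hS.map_conj, conj_ofReal]

lemma ofReal_re_deriv (hS : IsSine S) (x : ℝ) : ((deriv S x).re : ℂ) = deriv S x := by
  rw [← conj_eq_iff_re, ← hS.deriv_conj, conj_ofReal]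

lemma conj_γ_mul_ofReal (x : ℝ) : starRingEnd ℂ (γ * x) = -(I * (γ * x)) := by
  rw [map_mul, conj_γ, conj_ofReal]; ring

/-- On the ray through γ conjugation is multiplication by -i, so the symmetries make S(γx)/γ real.
-/
lemma map_γ_mul (hS : IsSine S) (x : ℝ) :
    S (γ * x) = γ * ((starRingEnd ℂ γ * S (γ * x)).re : ℂ) := by
  have h : starRingEnd ℂ (starRingEnd ℂ γ * S (γ * x)) = starRingEnd ℂ γ * S (γ * x) := by
    rw [map_mul, ← hS.map_conj, conj_γ_mul_ofReal, hS.map_neg, hS.map_I_mul, conj_conj, conj_γ]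
    ring
  rw [conj_eq_iff_re.1 h]
  linear_combination -(S (γ * x)) * conj_γ_mul

lemma ofReal_re_deriv_γ (hS : IsSine S) (x : ℝ) :
    ((deriv S (γ * x)).re : ℂ) = deriv S (γ * x) := by
  rw [← conj_eq_iff_re, ← hS.deriv_conj, conj_γ_mul_ofReal, hS.deriv_neg, hS.deriv_I_mul]

lemma norm_γ_mul (x : ℝ) : ‖γ * x‖ = |x| := by simp [norm_γ]

/-- As γ⁴ = -1, the real function ρ(x) = S(γx)/γ satisfies ρ'² = 1 + ρ⁴; the right side never
vanishes, so ρ' stays the positive root. -/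
lemma exists_K (hS : IsSine S) : ∃ K ∈ Ioo (0 : ℝ) 1, S (γ * K) = γ ∧
    ∀ K' ∈ Ioo (0 : ℝ) 1, S (γ * K') = γ → K' = K := by
  set ρ : ℝ → ℝ := fun x => (starRingEnd ℂ γ * S (γ * x)).re with hρ
  set σ : ℝ → ℝ := fun x => (deriv S (γ * x)).re with hσ
  have h2 : (1 : ℝ) < Real.sqrt 2 := by
    rw [Real.lt_sqrt] <;> norm_num
  have han : ∀ x ∈ Icc (0 : ℝ) 1, AnalyticAt ℂ S (γ * x) := fun x hx =>
    (hS.analyticAt_of_norm_lt_sqrt_two (by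
      rw [norm_γ_mul, abs_of_nonneg hx.1]; exact hx.2.trans_lt h2)).1
  have hd : ∀ x ∈ Icc (0 : ℝ) 1, HasDerivAt ρ (σ x) x := by
    intro x hx
    have h3 : HasDerivAt (fun w : ℂ => starRingEnd ℂ γ * S (γ * w)) (deriv S (γ * x)) (x : ℂ) := by
      have h4 : HasDerivAt (fun w : ℂ => γ * w) γ (x : ℂ) := by
        simpa using (hasDerivAt_id (x : ℂ)).const_mul γ
      convert! ((han x hx).differentiableAt.hasDerivAt.comp (x : ℂ) h4).const_mul
        (starRingEnd ℂ γ) using 1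
      linear_combination -(deriv S (γ * x)) * conj_γ_mul
    exact h3.real_of_complex
  have hsq : ∀ x ∈ Icc (0 : ℝ) 1, σ x ^ 2 = 1 + ρ x ^ 4 := by
    intro x hx
    have h3 := hS.deriv_sq (han x hx)
    rw [← hS.ofReal_re_deriv_γ, hS.map_γ_mul] at h3
    have h4 : ((σ x ^ 2 : ℝ) : ℂ) = ((1 + ρ x ^ 4 : ℝ) : ℂ) := by
      push_cast
      rw [h3, mul_pow, show γ ^ 4 = (γ ^ 2) ^ 2 by ring, γ_sq, I_sq]
      ring
    exact_mod_cast h4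
  have hσeq : EqOn σ (fun x => Real.sqrt (1 + ρ x ^ 4)) (Icc 0 1) := by
    refine isPreconnected_Icc.eq_of_sq_eq (fun x hx => ?_) (fun x hx => ?_) (fun x hx => ?_)
      (fun {x} _ => by positivity) (left_mem_Icc.2 zero_le_one) ?_
    · have h3 : ContinuousAt (fun x : ℝ => deriv S (γ * x)) x :=
        ContinuousAt.comp' (g := deriv S) (f := fun x : ℝ => γ * (x : ℂ))
          (han x hx).deriv.continuousAt (by fun_prop)
      exact (continuous_re.continuousAt.comp h3).continuousWithinAt
    · exact (((hd x hx).continuousAt.pow 4).const_add 1).sqrt.continuousWithinAt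
    · simp only [Pi.pow_apply, hsq x hx]
      rw [Real.sq_sqrt (by positivity)]
    · simp [hσ, hρ, hS.map_zero, hS.germ.deriv_zero]
  obtain ⟨K, hK, hK1, huniq⟩ := exists_unique_eq_one (ρ := ρ)
    (fun x hx => (hd x hx).congr_deriv (hσeq hx)) (by simp [hρ, hS.map_zero])
  refine ⟨K, hK, ?_, fun K' hK' h => huniq K' hK' ?_⟩
  · rw [hS.map_γ_mul]
    change γ * ((ρ K : ℝ) : ℂ) = γ
    rw [hK1, ofReal_one, mul_one]
  · simp only [hρ, h, conj_γ_mul, one_re]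

lemma r_le_K (hS : IsSine S) {K : ℝ} (hK : 0 < K) (h : S (γ * K) = γ) : r ≤ K := by
  by_contra hlt
  have := hS.norm_lt_one (z := γ * K) (by rw [norm_γ_mul, abs_of_pos hK]; exact not_le.1 hlt)
  rw [h, norm_γ] at this
  exact lt_irrefl _ this

lemma re_map_pos (hS : IsSine S) {x : ℝ} (h0 : 0 < x) (hx : x < r) : 0 < (S x).re := by
  have h1 := hS.norm_sub_self_lt (z := x) (by simpa [abs_of_pos h0] using hx)
    (ofReal_ne_zero.2 h0.ne')
  have h2 := (abs_lt.1 ((abs_re_le_norm _).trans_lt h1)).1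
  simp only [sub_re, ofReal_re, norm_real, Real.norm_of_nonneg h0.le] at h2
  linarith

/-- Since (1-i)γ = √2, complex multiplication at γK gives S(√2 K)² = 1. Duplication from √2 K/2,
where S and S' are real and nonnegative, excludes the value -1. -/
lemma map_sqrt_two_mul (hS : IsSine S) {K : ℝ} (hK : K ∈ Ioo (0 : ℝ) 1) (h : S (γ * K) = γ) :
    S ((Real.sqrt 2 * K : ℝ) : ℂ) = 1 := by
  have h4 : γ ^ 4 = -1 := by rw [show γ ^ 4 = (γ ^ 2) ^ 2 by ring, γ_sq, I_sq]
  have hγ0 : γ ≠ 0 := fun h => by simpa [h] using norm_γ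
  have han : AnalyticAt ℂ S (γ * K) := hS.analyticAt_of_ne_zero (by rw [h]; exact hγ0)
  have h1 := (hS.map_one_sub_I_mul han (by rw [h, h4]; norm_num)).2
  have h2 := hS.deriv_sq han
  have harg : (1 - I) * (γ * K) = ((Real.sqrt 2 * K : ℝ) : ℂ) := by
    push_cast
    rw [← sqrt_two_mul_conj_γ]
    linear_combination (Real.sqrt 2 * K : ℂ) * conj_γ_mul
  rw [harg, h] at h1
  rw [h, h4] at h2
  have hsq : S ((Real.sqrt 2 * K : ℝ) : ℂ) ^ 2 = 1 := by
    rw [h1, div_pow, h2, mul_pow, γ_sq]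
    linear_combination (I / 2) * I_sq - I_sq
  have hpos : 0 < Real.sqrt 2 * K := by have := hK.1; positivity
  have hlt : Real.sqrt 2 * K < Real.sqrt 2 := by
    have : 0 < Real.sqrt 2 := by positivity
    nlinarith [hK.2]
  set x := Real.sqrt 2 * K / 2 with hx
  have hxr : x < r := by rw [hx, div_lt_iff₀ two_pos]; linarith [two_mul_r]
  have hx0 : 0 < x := by positivity
  have hxn : ‖(x : ℂ)‖ < r := by simpa [abs_of_pos hx0] using hxr
  have hdup := (hS.analyticAt_of_norm_lt_sqrt_two (z := ((Real.sqrt 2 * K : ℝ) : ℂ))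
    (by rw [norm_real, Real.norm_of_nonneg hpos.le]; exact hlt)).2
  rw [show ((Real.sqrt 2 * K : ℝ) : ℂ) / 2 = ((x : ℝ) : ℂ) by rw [hx]; push_cast; ring] at hdup
  have ha := hS.re_map_pos hx0 hxr
  have hb : 0 ≤ (deriv S x).re := by
    rw [hS.deriv_eq_cpow hxn, one_div, cpow_inv_two_re]
    positivity
  rw [← hS.ofReal_re_map x, ← hS.ofReal_re_deriv x] at hdup
  rcases mul_self_eq_one_iff.1 ((sq _).symm.trans hsq) with h5 | h5
  · exact h5
  · exfalso
    rw [h5] at hdup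
    have h6 : (-1 : ℝ) = 2 * (S x).re * (deriv S x).re / (1 + (S x).re ^ 4) := by
      exact_mod_cast hdup
    have h7 : 0 ≤ 2 * (S x).re * (deriv S x).re / (1 + (S x).re ^ 4) := by positivity
    linarith

/-! ### The half period -/

lemma deriv_eq_zero_of_map_eq_one (hS : IsSine S) {z : ℂ} (h : S z = 1) : deriv S z = 0 := by
  have h1 := hS.deriv_sq (hS.analyticAt_of_ne_zero (h ▸ one_ne_zero))
  rw [h] at h1
  exact pow_eq_zero_iff two_ne_zero |>.1 (by rw [h1]; norm_num)

lemma hasDerivAt_deriv_div (hS : IsSine S) {z : ℂ} (hz : AnalyticAt ℂ S z) (h : 1 + S z ^ 2 ≠ 0) :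
    HasDerivAt (fun w => deriv S w / (1 + S w ^ 2)) (-2 * S z / (1 + S z ^ 2)) z := by
  convert! (hS.hasDerivAt_deriv hz).div
    ((hz.differentiableAt.hasDerivAt.fun_pow 2).const_add 1) h using 1
  have := hS.deriv_sq hz
  field_simp
  simp only [Nat.cast_ofNat, Nat.add_one_sub_one, pow_one]
  linear_combination (2 * S z) * this

/-- S(L-z) and S'/(1+S²) both solve f'² = 1 - f⁴, with value 0 and derivative -1 at L. The
comparison is made at L because at 0 the derivative vanishes and uniqueness is not available. -/
lemma eventually_map_sub (hS : IsSine S) {L : ℂ} (hL : S L = 1) (y : ℂ) :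
    ∀ᶠ z in 𝓝[≠] y, S (L - z) * (1 + S z ^ 2) = deriv S z := by
  have haL : AnalyticAt ℂ S L := hS.analyticAt_of_ne_zero (hL ▸ one_ne_zero)
  have hdL := hS.deriv_eq_zero_of_map_eq_one hL
  have hne : ∀ᶠ z in 𝓝 L, 1 + S z ^ 2 ≠ 0 :=
    (analyticAt_const.add (haL.pow 2)).continuousAt.eventually_ne (by simp [hL])
  have htend : Tendsto (fun z => L - z) (𝓝 L) (𝓝 0) := by
    have : ContinuousAt (fun z : ℂ => L - z) L := by fun_prop
    simpa [ContinuousAt] using this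
  have hdf : ∀ z, deriv (fun z => S (L - z)) z = -deriv S (L - z) := fun z => by
    rw [deriv_comp_const_sub]
  have hd : ∀ᶠ z in 𝓝 L, HasDerivAt (fun w => deriv S w / (1 + S w ^ 2))
      (-2 * S z / (1 + S z ^ 2)) z := by
    filter_upwards [haL.eventually_analyticAt, hne] with z h1 h2
    exact hS.hasDerivAt_deriv_div h1 h2
  have key : (fun z => S (L - z)) =ᶠ[𝓝 L] fun z => deriv S z / (1 + S z ^ 2) := by
    refine eventuallyEq_of_deriv_sq (κ := 1) ?_
      (haL.deriv.div (analyticAt_const.add (haL.pow 2)) hne.self_of_nhds) ?_ ?_ ?_ ?_ ?_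
    · refine AnalyticAt.fun_comp (g := S) (f := fun z => L - z) ?_ (by fun_prop)
      simpa using hS.germ.analyticAt
    · filter_upwards [htend.eventually hS.germ.deriv_sq] with z hz
      rw [hdf, neg_sq, hz, one_mul]
    · filter_upwards [hd, hne, haL.eventually_analyticAt] with z h1 h2 h3
      rw [h1.deriv]
      have := hS.deriv_sq h3
      field_simp
      rw [show deriv S z ^ 4 = (deriv S z ^ 2) ^ 2 by ring, this]
      ring
    · simp [hdL, hS.map_zero]
    · rw [hdf, hd.self_of_nhds.deriv, hL, sub_self, hS.germ.deriv_zero]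
      norm_num
    · rw [hd.self_of_nhds.deriv, hL]
      norm_num
  have hmer : Meromorphic fun z => S (L - z) := fun z =>
    (hS.meromorphic (L - z)).comp_analyticAt (g := fun z => L - z) (by fun_prop)
  refine eventuallyEq_nhdsNE_of_meromorphic
    (hmer.mul ((Meromorphic.const 1).add (hS.meromorphic.pow (n := 2))))
    hS.meromorphic_deriv (x := L) ?_ y
  refine Eventually.filter_mono nhdsWithin_le_nhds ?_
  filter_upwards [key, hne] with z h1 h2
  simp only [Pi.mul_apply, Pi.add_apply, h1]
  exact div_mul_cancel₀ _ h2

lemma eventually_one_add_sq_ne_zero (hS : IsSine S) : ∀ᶠ z in 𝓝 0, 1 + S z ^ 2 ≠ 0 :=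
  (analyticAt_const.add (hS.germ.analyticAt.pow 2)).continuousAt.eventually_ne
    (by simp [hS.map_zero])

/-- S' and S² are even, hence so is S(L-z) as a function of z. -/
lemma map_two_mul_sub (hS : IsSine S) {L : ℂ} (hL : S L = 1) (z : ℂ) : S (2 * L - z) = S z := by
  have h1 := meromorphicNFOn_comp_affine hS.nf (-1) L
  have h2 := meromorphicNFOn_comp_affine hS.nf 1 L
  have hneg : Tendsto (fun z : ℂ => -z) (𝓝[≠] 0) (𝓝[≠] 0) := by
    refine tendsto_nhdsWithin_of_tendsto_nhds_of_eventually_within _ ?_ ?_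
    · have : ContinuousAt (fun z : ℂ => -z) 0 := by fun_prop
      simpa [ContinuousAt] using this.tendsto.mono_left nhdsWithin_le_nhds
    · filter_upwards [self_mem_nhdsWithin] with w hw
      simpa using hw
  have h3 := congrFun (eq_of_meromorphicNFOn h1 h2 (x := 0) (by
    filter_upwards [hS.eventually_map_sub hL 0, hneg.eventually (hS.eventually_map_sub hL 0),
      hS.eventually_one_add_sq_ne_zero.filter_mono nhdsWithin_le_nhds] with w h3 h4 h5
    rw [hS.deriv_neg, hS.map_neg, neg_sq, ← h3] at h4
    have h6 := mul_right_cancel₀ h5 h4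
    rw [show -1 * w + L = L - w by ring, show 1 * w + L = L - -w by ring, h6])) (z - L)
  rw [show -1 * (z - L) + L = 2 * L - z by ring, show 1 * (z - L) + L = z by ring] at h3
  exact h3

lemma antiperiodic (hS : IsSine S) {L : ℂ} (hL : S L = 1) : Function.Antiperiodic S (2 * L) := by
  intro z
  rw [show z + 2 * L = 2 * L - -z by ring, hS.map_two_mul_sub hL, hS.map_neg]

lemma antiperiodic_I (hS : IsSine S) {L : ℂ} (hL : S L = 1) :
    Function.Antiperiodic S (2 * I * L) := by
  intro z
  have h : z + 2 * I * L = I * (-(I * z) + 2 * L) := by linear_combination z * I_sq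
  rw [h, hS.map_I_mul, hS.antiperiodic hL, hS.map_neg, hS.map_I_mul]
  linear_combination S z * I_sq

/-- The formula for S(L-z) is applied at i(z+L), then at z to eliminate S(z+L) and its derivative.
The resulting relation makes translation by (1+i)L exchange zeros and poles. -/
lemma eventually_map_add_mul (hS : IsSine S) {L : ℂ} (hL : S L = 1) (y : ℂ) :
    ∀ᶠ z in 𝓝[≠] y, S (z + (1 + I) * L) * S z = -I := by
  have haL : AnalyticAt ℂ S L := hS.analyticAt_of_ne_zero (hL ▸ one_ne_zero)
  have hmer : Meromorphic fun z => S (z + (1 + I) * L) := fun z =>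
    (hS.meromorphic _).comp_analyticAt (g := fun z => z + (1 + I) * L) (by fun_prop)
  refine eventuallyEq_nhdsNE_of_meromorphic (hmer.mul hS.meromorphic)
    (Meromorphic.const (-I)) (x := 0) ?_ y
  have hshift : (fun z => S (z + L)) =ᶠ[𝓝 0] fun z => deriv S z / (1 + S z ^ 2) := by
    have h1 : AnalyticAt ℂ (fun z => S (z + L)) 0 :=
      AnalyticAt.fun_comp (g := S) (f := fun z => z + L) (by simpa using haL) (by fun_prop)
    refine (h1.continuousAt.eventuallyEq_nhds_iff_eventuallyEq_nhdsNE
      (hS.hasDerivAt_deriv_div hS.germ.analyticAt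
        hS.eventually_one_add_sq_ne_zero.self_of_nhds).continuousAt).1 ?_
    filter_upwards [hS.eventually_map_sub hL 0,
      hS.eventually_one_add_sq_ne_zero.filter_mono nhdsWithin_le_nhds] with z h2 h3
    rw [eq_div_iff h3, ← h2, show L - z = 2 * L - (z + L) by ring, hS.map_two_mul_sub hL]
  have htend : Tendsto (fun z : ℂ => I * (z + L)) (𝓝[≠] 0) (𝓝[≠] (I * L)) := by
    refine tendsto_nhdsWithin_of_tendsto_nhds_of_eventually_within _ ?_ ?_
    · have : ContinuousAt (fun z : ℂ => I * (z + L)) 0 := by fun_prop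
      simpa [ContinuousAt] using this.tendsto.mono_left nhdsWithin_le_nhds
    · filter_upwards [self_mem_nhdsWithin] with w hw
      simpa using hw
  have hball : ∀ᶠ z in 𝓝 (0 : ℂ), ‖z‖ < r := by
    filter_upwards [ball_mem_nhds (0 : ℂ) r_pos] with z hz
    simpa using hz
  filter_upwards [hshift.filter_mono nhdsWithin_le_nhds,
    hshift.deriv.filter_mono nhdsWithin_le_nhds, htend.eventually (hS.eventually_map_sub hL (I * L)),
    hS.eventually_one_add_sq_ne_zero.filter_mono nhdsWithin_le_nhds,
    hball.filter_mono nhdsWithin_le_nhds, self_mem_nhdsWithin] with z h1 h2 h3 h4 h5 h6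
  have hza := hS.analyticAt_of_norm_lt_r h5
  have hz0 : S z ≠ 0 := fun h => h6 (hS.eq_zero_of_norm_lt_r h5 h)
  rw [(hS.hasDerivAt_deriv_div hza h4).deriv, deriv_comp_add_const] at h2
  rw [hS.deriv_I_mul, hS.map_I_mul, mul_pow, I_sq, h1, h2,
    show L - I * (z + L) = -(I * (z + (1 + I) * L)) by linear_combination L * I_sq,
    hS.map_neg, hS.map_I_mul] at h3
  have h7 := hS.deriv_sq hza
  simp only [Pi.mul_apply]
  have h8 : -(I * S (z + (1 + I) * L)) * ((1 + S z ^ 2) ^ 2 - deriv S z ^ 2) =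
      -2 * S z * (1 + S z ^ 2) := by
    field_simp at h3
    linear_combination h3
  rw [h7] at h8
  -- Uses (1+S²)² - (1-S⁴) = 2S²(1+S²).
  have h9 : (S z * (1 + S z ^ 2)) * (I * S (z + (1 + I) * L) * S z - 1) = 0 := by
    linear_combination (-1 / 2) * h8
  have h10 := (mul_eq_zero.1 h9).resolve_left (mul_ne_zero hz0 h4)
  linear_combination (-I) * h10 + S (z + (1 + I) * L) * S z * I_sq

/-! ### Zeros and poles -/

lemma order_add (hS : IsSine S) {L : ℂ} (hL : S L = 1) (z : ℂ) :
    meromorphicOrderAt S (z + (1 + I) * L) + meromorphicOrderAt S z = 0 := by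
  rw [← meromorphicOrderAt_comp_add_const_eq_meromorphicOrderAt (f := S) (c := (1 + I) * L)]
  have hmer : MeromorphicAt (S ∘ (· + (1 + I) * L)) z :=
    (hS.meromorphic _).comp_analyticAt (g := fun z => z + (1 + I) * L) (by fun_prop)
  have hcongr : (S ∘ (· + (1 + I) * L)) * S =ᶠ[𝓝[≠] z] fun _ => -I :=
    hS.eventually_map_add_mul hL z
  rw [← meromorphicOrderAt_mul hmer (hS.meromorphic z), meromorphicOrderAt_congr hcongr,
    meromorphicOrderAt_const, if_neg (by simp)]

lemma exists_map_add_lattice (hS : IsSine S) {L : ℂ} (hL : S L = 1) (m n : ℤ) :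
    ∃ ε : ℂ, ε ≠ 0 ∧ ∀ z, S (z + (2 * L * m + 2 * I * L * n)) = ε * S z := by
  refine ⟨((m.negOnePow : ℤ) : ℂ) * ((n.negOnePow : ℤ) : ℂ), ?_, fun z => ?_⟩
  · simp
  · have h1 := (hS.antiperiodic hL).add_zsmul_eq m (x := z)
    have h2 := (hS.antiperiodic_I hL).add_zsmul_eq n (x := z + m • (2 * L))
    rw [h1] at h2
    rw [show z + (2 * L * m + 2 * I * L * n) = z + m • (2 * L) + n • (2 * I * L) by
      simp only [zsmul_eq_mul]; ring, h2]
    simp only [zsmul_eq_mul]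
    ring

lemma order_add_lattice (hS : IsSine S) {L : ℂ} (hL : S L = 1) (z : ℂ) (m n : ℤ) :
    meromorphicOrderAt S (z + (2 * L * m + 2 * I * L * n)) = meromorphicOrderAt S z := by
  obtain ⟨ε, hε, h⟩ := hS.exists_map_add_lattice hL m n
  rw [← meromorphicOrderAt_comp_add_const_eq_meromorphicOrderAt (f := S)
    (c := 2 * L * m + 2 * I * L * n)]
  have : S ∘ (· + (2 * L * m + 2 * I * L * n)) = (fun _ => ε) * S := funext h
  rw [this]
  exact meromorphicOrderAt_mul_of_ne_zero analyticAt_const hε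

lemma order_zero (hS : IsSine S) : meromorphicOrderAt S 0 = 1 := by
  have h := hS.germ.analyticAt.analyticOrderAt_sub_eq_one_of_deriv_ne_zero
    (by simp [hS.germ.deriv_zero])
  simp only [hS.map_zero, sub_zero] at h
  rw [hS.germ.analyticAt.meromorphicOrderAt_eq, h]
  rfl

/-- Rounding moves z into the square |Re|, |Im| ≤ L, whose points have norm at most √2 L < 2, where
0 is the only zero. -/
lemma exists_lattice_of_order_pos (hS : IsSine S) {L : ℝ} (hL : S L = 1) (hL0 : 0 < L)
    (hL2 : L < Real.sqrt 2) {z : ℂ} (hz : 0 < meromorphicOrderAt S z) :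
    ∃ m n : ℤ, z = 2 * L * m + 2 * I * L * n := by
  set m := round (z.re / (2 * L)) with hm
  set n := round (z.im / (2 * L)) with hn
  have h2L : 0 < 2 * L := by positivity
  have habs : ∀ x : ℝ, |x - 2 * L * round (x / (2 * L))| ≤ L := by
    intro x
    have h1 := abs_sub_round (x / (2 * L))
    have h2 : x - 2 * L * round (x / (2 * L)) = 2 * L * (x / (2 * L) - round (x / (2 * L))) := by
      field_simp
    rw [h2, abs_mul, abs_of_pos h2L]
    nlinarith
  have hord := hS.order_add_lattice hL z (-m) (-n)
  set w : ℂ := z + (2 * L * (-m : ℤ) + 2 * I * L * (-n : ℤ)) with hw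
  have hre : w.re = z.re - 2 * L * m := by
    simp [hw]; ring
  have him : w.im = z.im - 2 * L * n := by
    simp [hw]; ring
  have hnorm : ‖w‖ < 2 := by
    have h1 := sq_le_sq' (abs_le.1 (habs z.re)).1 (abs_le.1 (habs z.re)).2
    have h2 := sq_le_sq' (abs_le.1 (habs z.im)).1 (abs_le.1 (habs z.im)).2
    rw [← hm, ← hre] at h1
    rw [← hn, ← him] at h2
    have h3 : L ^ 2 < 2 := by
      have := Real.sq_sqrt (show (0 : ℝ) ≤ 2 by norm_num)
      nlinarith
    have h4 := Complex.sq_norm w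
    rw [normSq_apply] at h4
    nlinarith [norm_nonneg w]
  rw [← hord] at hz
  have hw0 := hS.eq_zero_of_norm_lt_two hnorm (hS.analyticAt_of_order_nonneg hz.le) (by
    by_contra h
    rw [(hS.nf (mem_univ w)).meromorphicOrderAt_eq_zero_iff.2 h] at hz
    exact lt_irrefl _ hz)
  refine ⟨m, n, ?_⟩
  rw [hw] at hw0
  push_cast at hw0
  linear_combination hw0

lemma two_mul_mul_γ {K L : ℝ} (h : L = Real.sqrt 2 * K) : 2 * K * γ = (1 + I) * L := by
  rw [h]
  push_cast
  linear_combination (Real.sqrt 2 * K : ℂ) * sqrt_two_mul_γ - K * γ * sqrt_two_sq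

lemma two_mul_mul_conj_γ {K L : ℝ} (h : L = Real.sqrt 2 * K) :
    2 * K * starRingEnd ℂ γ = (1 - I) * L := by
  rw [h]
  push_cast
  linear_combination (Real.sqrt 2 * K : ℂ) * sqrt_two_mul_conj_γ -
    K * starRingEnd ℂ γ * sqrt_two_sq

/-- As 2Kγ = (1+i)L, the four basic points represent the four classes of (1+i)L + 2Lℤ + 2iLℤ modulo
4L and 4iL, whence the parity cases. -/
lemma mem_poles_iff {K L : ℝ} (h : L = Real.sqrt 2 * K) (z : ℂ) :
    z ∈ poles K L ↔ ∃ m n : ℤ, z = (2 * L * m + 2 * I * L * n) + (1 + I) * L := by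
  simp only [poles, basicPoles, mem_ofPred_eq, mem_insert_iff, mem_singleton_iff,
    two_mul_mul_γ h, two_mul_mul_conj_γ h]
  constructor
  · rintro ⟨p, rfl | rfl | rfl | rfl, m, n, rfl⟩
    · exact ⟨2 * m, 2 * n, by push_cast; ring⟩
    · exact ⟨2 * m - 1, 2 * n - 1, by push_cast; ring⟩
    · exact ⟨2 * m, 2 * n - 1, by push_cast; ring⟩
    · exact ⟨2 * m - 1, 2 * n, by push_cast; ring⟩
  · rintro ⟨m, n, rfl⟩
    obtain ⟨m', rfl | rfl⟩ := m.even_or_odd'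
    · obtain ⟨n', rfl | rfl⟩ := n.even_or_odd'
      · exact ⟨_, Or.inl rfl, m', n', by push_cast; ring⟩
      · exact ⟨_, Or.inr (Or.inr (Or.inl rfl)), m', n' + 1, by push_cast; ring⟩
    · obtain ⟨n', rfl | rfl⟩ := n.even_or_odd'
      · exact ⟨_, Or.inr (Or.inr (Or.inr rfl)), m' + 1, n', by push_cast; ring⟩
      · exact ⟨_, Or.inr (Or.inl rfl), m' + 1, n' + 1, by push_cast; ring⟩

lemma order_of_mem_poles (hS : IsSine S) {K L : ℝ} (h : L = Real.sqrt 2 * K) (hL : S L = 1)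
    {z : ℂ} (hz : z ∈ poles K L) : meromorphicOrderAt S z = -1 := by
  obtain ⟨m, n, rfl⟩ := (mem_poles_iff h z).1 hz
  have h1 := hS.order_add hL (2 * L * m + 2 * I * L * n)
  have h2 := hS.order_add_lattice hL 0 m n
  rw [zero_add, hS.order_zero] at h2
  rw [h2] at h1
  generalize meromorphicOrderAt S (2 * L * m + 2 * I * L * n + (1 + I) * L) = o at h1 ⊢
  cases o with
  | top => simp at h1
  | coe k =>
    have h3 : k + 1 = 0 := by exact_mod_cast h1
    have h4 : k = -1 := by omega
    rw [h4]
    rfl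

/-- A pole shifted by -(1+i)L is a zero, hence a lattice point. -/
lemma analyticAt_iff (hS : IsSine S) {K L : ℝ} (h : L = Real.sqrt 2 * K) (hL : S L = 1)
    (hL0 : 0 < L) (hL2 : L < Real.sqrt 2) (z : ℂ) : AnalyticAt ℂ S z ↔ z ∉ poles K L := by
  constructor
  · intro ha hz
    have h1 := ha.meromorphicOrderAt_nonneg
    rw [hS.order_of_mem_poles h hL hz] at h1
    exact absurd h1 (by decide)
  · intro hz
    by_contra ha
    have h1 := hS.order_neg ha
    have h2 := hS.order_add hL (z - (1 + I) * L)
    rw [sub_add_cancel] at h2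
    have h3 : 0 < meromorphicOrderAt S (z - (1 + I) * L) := by
      by_contra h4
      exact absurd h2 (add_neg_of_neg_of_nonpos h1 (not_lt.1 h4)).ne
    obtain ⟨m, n, hmn⟩ := hS.exists_lattice_of_order_pos hL hL0 hL2 h3
    exact hz ((mem_poles_iff h z).2 ⟨m, n, by rw [← hmn]; ring⟩)

end IsSine

/-! ### Comparison with solutions on the discs, and uniqueness of L. -/

lemma analyticOnNhd_of_hasDerivAt {f f' : ℂ → ℂ} {U : Set ℂ} (hU : IsOpen U)
    (h : ∀ z ∈ U, HasDerivAt f (f' z) z) : AnalyticOnNhd ℂ f U :=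
  DifferentiableOn.analyticOnNhd
    (fun z hz => (h z hz).differentiableAt.differentiableWithinAt) hU

namespace IsSine

variable {S : ℂ → ℂ}

lemma eqOn_ball_of_germ (hS : IsSine S) {s : ℂ → ℂ} (hs : AnalyticOnNhd ℂ s (ball 0 r))
    (hg : IsSineGerm s) : EqOn s S (ball 0 r) :=
  hs.eqOn_of_preconnected_of_eventuallyEq
    (fun z hz => hS.analyticAt_of_norm_lt_r (by simpa using hz))
    (convex_ball _ _).isPreconnected (mem_ball_self r_pos) (hg.eventuallyEq hS.germ)

lemma solvesSineIVP (hS : IsSine S) : SolvesSineIVP S (ball 0 r) where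
  zero := hS.map_zero
  hasDerivAt z hz := by
    have hz' : ‖z‖ < r := by simpa using hz
    rw [← hS.deriv_eq_cpow hz']
    exact (hS.analyticAt_of_norm_lt_r hz').differentiableAt.hasDerivAt

lemma eqOn_of_solvesSineIVP (hS : IsSine S) {s : ℂ → ℂ} (hs : SolvesSineIVP s (ball 0 r)) :
    EqOn s S (ball 0 r) := by
  have ha := analyticOnNhd_of_hasDerivAt isOpen_ball hs.hasDerivAt
  have h0 := mem_ball_self (x := (0 : ℂ)) r_pos
  refine hS.eqOn_ball_of_germ ha ⟨ha 0 h0, hs.zero, ?_, ?_⟩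
  · rw [(hs.hasDerivAt 0 h0).deriv, hs.zero]
    simp
  · filter_upwards [ball_mem_nhds (0 : ℂ) r_pos] with z hz
    rw [(hs.hasDerivAt z hz).deriv, cpow_half_sq]

/-- The system satisfied by `S` and its translate `C z = S (L - z)`. -/
lemma joint (hS : IsSine S) {L : ℂ} (hL : S L = 1) {z : ℂ} (hz : AnalyticAt ℂ S z)
    (h : 1 + S z ^ 2 ≠ 0) :
    HasDerivAt S (S (L - z) * (1 + S z ^ 2)) z ∧
    HasDerivAt (fun w => S (L - w)) (-S z * (1 + S (L - z) ^ 2)) z ∧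
    S z ^ 2 + S z ^ 2 * S (L - z) ^ 2 + S (L - z) ^ 2 = 1 := by
  have hq : AnalyticAt ℂ (fun z => 1 + S z ^ 2) z := analyticAt_const.add (hz.pow 2)
  have hnf : MeromorphicNFAt (fun w => S (L - w)) z := by
    have := meromorphicNFOn_comp_affine hS.nf (-1) L (mem_univ z)
    refine (meromorphicNFAt_congr (Eventually.of_forall fun w => ?_)).1 this
    congr 1
    ring
  have hev : (fun w => S (L - w)) =ᶠ[𝓝 z] fun w => deriv S w / (1 + S w ^ 2) := by
    refine (hnf.eventuallyEq_nhdsNE_iff_eventuallyEq_nhds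
      (hz.deriv.div hq h).meromorphicNFAt).1 ?_
    filter_upwards [hS.eventually_map_sub hL z,
      (hq.continuousAt.eventually_ne h).filter_mono nhdsWithin_le_nhds] with w h1 h2
    simp only [Pi.div_apply]
    rw [eq_div_iff h2, h1]
  have hval : S (L - z) = deriv S z / (1 + S z ^ 2) := hev.self_of_nhds
  have hsq := hS.deriv_sq hz
  have hsq' : S (L - z) ^ 2 * (1 + S z ^ 2) = 1 - S z ^ 2 := by
    rw [hval]
    field_simp
    linear_combination hsq
  refine ⟨?_, ?_, by linear_combination hsq'⟩
  · rw [hval, div_mul_cancel₀ _ h]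
    exact hz.differentiableAt.hasDerivAt
  · refine ((hS.hasDerivAt_deriv_div hz h).congr_of_eventuallyEq hev).congr_deriv ?_
    rw [div_eq_iff h]
    linear_combination S z * hsq'

lemma solvesIVP (hS : IsSine S) {L : ℂ} (hL : S L = 1) :
    SolvesIVP S (fun z => S (L - z)) (ball 0 r) := by
  have key : ∀ z ∈ ball (0 : ℂ) r, _ := fun z hz =>
    hS.joint hL (hS.analyticAt_of_norm_lt_r (by simpa using hz))
      (one_add_pow_ne_zero (hS.norm_lt_one (by simpa using hz)) (by norm_num))
  exact ⟨hS.map_zero, by simpa using hL, fun z hz => (key z hz).1, fun z hz => (key z hz).2.1⟩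

/-- (1+s²)(1+c²) is a first integral with value 2. Eliminating c gives s'² = 1 - s⁴, so s = S; then
c is recovered from s' = c(1+s²), as 1 + S² ≠ 0 on the disc. -/
lemma eqOn_of_solvesIVP (hS : IsSine S) {L : ℂ} (hL : S L = 1) {s c : ℂ → ℂ}
    (h : SolvesIVP s c (ball 0 r)) :
    EqOn s S (ball 0 r) ∧ EqOn c (fun z => S (L - z)) (ball 0 r) := by
  have hs := analyticOnNhd_of_hasDerivAt isOpen_ball h.hasDerivAt_s
  have h0 := mem_ball_self (x := (0 : ℂ)) r_pos
  have hQ : ∀ z ∈ ball (0 : ℂ) r,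
      HasDerivAt (fun w => (1 + s w ^ 2) * (1 + c w ^ 2)) 0 z := by
    intro z hz
    convert! (((h.hasDerivAt_s z hz).fun_pow 2).const_add 1).mul
      (((h.hasDerivAt_c z hz).fun_pow 2).const_add 1) using 1
    simp only [Nat.cast_ofNat, Nat.add_one_sub_one, pow_one]
    ring
  have hQ2 : ∀ z ∈ ball (0 : ℂ) r, (1 + s z ^ 2) * (1 + c z ^ 2) = 2 := by
    intro z hz
    have h1 := isOpen_ball.is_const_of_deriv_eq_zero (convex_ball (0 : ℂ) r).isPreconnected
      (fun w hw => (hQ w hw).differentiableAt.differentiableWithinAt)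
      (fun w hw => (hQ w hw).deriv) hz h0
    simp only [h.s_zero, h.c_zero] at h1
    rw [h1]
    norm_num
  have hsS : EqOn s S (ball 0 r) := by
    refine hS.eqOn_ball_of_germ hs ⟨hs 0 h0, h.s_zero, ?_, ?_⟩
    · rw [(h.hasDerivAt_s 0 h0).deriv, h.s_zero, h.c_zero]
      norm_num
    · filter_upwards [ball_mem_nhds (0 : ℂ) r_pos] with z hz
      rw [(h.hasDerivAt_s z hz).deriv]
      linear_combination (1 + s z ^ 2) * hQ2 z hz
  refine ⟨hsS, fun z hz => ?_⟩
  have h1 : HasDerivAt s (S (L - z) * (1 + S z ^ 2)) z :=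
    ((hS.solvesIVP hL).hasDerivAt_s z hz).congr_of_eventuallyEq
      (hsS.eventuallyEq_of_mem (isOpen_ball.mem_nhds hz))
  have h2 := (h.hasDerivAt_s z hz).unique h1
  rw [hsS hz] at h2
  exact mul_right_cancel₀ (one_add_pow_ne_zero (hS.norm_lt_one (by simpa using hz))
    two_ne_zero) h2

lemma dup_eq (hS : IsSine S) {z : ℂ} (hz : ‖z‖ < Real.sqrt 2) : dup S z = S z :=
  (hS.analyticAt_of_norm_lt_sqrt_two hz).2.symm

lemma dup_dup_eq (hS : IsSine S) {z : ℂ} (hz : ‖z‖ < 2 * Real.sqrt 2) : dup (dup S) z = S z := by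
  have hw : ‖z / 2‖ < Real.sqrt 2 := by
    rw [norm_div, Complex.norm_ofNat, div_lt_iff₀ two_pos]
    linarith
  have ha := (hS.analyticAt_of_norm_lt_sqrt_two hw).1
  have hev : dup S =ᶠ[𝓝 (z / 2)] S := by
    filter_upwards [isOpen_ball.mem_nhds (mem_ball_zero_iff.2 hw)] with w hw'
    exact hS.dup_eq (by simpa using hw')
  have hz2 : 2 * (z / 2) = z := mul_div_cancel₀ z two_ne_zero
  rw [dup, hev.deriv_eq, hev.self_of_nhds]
  by_cases h : 1 + S (z / 2) ^ 4 = 0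
  -- At a pole both sides are 0: division by zero on the left, normal form on the right.
  · have h1 := hS.eq_zero_of_not_analyticAt (hS.not_analyticAt_two_mul ha h)
    rw [hz2] at h1
    rw [h, h1, div_zero]
  · rw [← (hS.map_two_mul ha h).2, hz2]

/-- The reflections about L and L' compose to the period 2(L'-L), a zero of S of norm less than 2.
Its order 1 shows that it is not a pole. -/
lemma eq_of_map_eq_one (hS : IsSine S) {L L' : ℝ} (hL : S L = 1) (hL' : S L' = 1)
    (h : |L' - L| < 1) : L' = L := by
  set a : ℂ := 2 * L' - 2 * L with ha
  have hper : S ∘ (· + a) = S := by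
    funext z
    simp only [Function.comp_apply]
    rw [show z + a = 2 * L' - (2 * L - z) by rw [ha]; ring, hS.map_two_mul_sub hL',
      hS.map_two_mul_sub hL]
  have hord : meromorphicOrderAt S a = 1 := by
    rw [← hS.order_zero, ← congrArg (meromorphicOrderAt · 0) hper,
      meromorphicOrderAt_comp_add_const_eq_meromorphicOrderAt, zero_add]
  have hval : S a = 0 := by
    have := congrFun hper 0
    simpa [hS.map_zero] using this
  have hcast : a = ((2 * (L' - L) : ℝ) : ℂ) := by rw [ha]; push_cast; ring
  have h0 := hS.eq_zero_of_norm_lt_two (z := a) (by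
    rw [hcast, norm_real, Real.norm_eq_abs, abs_mul, abs_two]
    linarith) (hS.analyticAt_of_order_nonneg (by rw [hord]; exact zero_le_one)) hval
  rw [hcast, ofReal_eq_zero] at h0
  linarith

lemma r_le_of_map_eq_one (hS : IsSine S) {x : ℝ} (hx : 0 ≤ x) (h : S x = 1) : r ≤ x := by
  by_contra hlt
  have := hS.norm_lt_one (z := x) (by simpa [abs_of_nonneg hx] using hlt)
  rw [h, norm_one] at this
  exact lt_irrefl _ this

end IsSine

end Lemniscatic

-- `s₀`, `c₀`: the lemniscatic functions on the disc of radius `r`; `dup s₀`, `dup (dup s₀)`: the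
-- lemniscatic sine on the discs of radius `2 r`, `4 r`; `S`: the full lemniscatic sine.
-- Meromorphic functions are taken in normal form: analytic off the poles, with value `0` at poles.
theorem mainTheorem1 :
    ∃ (s₀ c₀ : ℂ → ℂ) (K L : ℝ) (S C : ℂ → ℂ),
      -- the lemniscatic functions on the disc of radius `r`
      (Lemniscatic.SolvesSineIVP s₀ (ball 0 Lemniscatic.r) ∧
        ∀ s : ℂ → ℂ, Lemniscatic.SolvesSineIVP s (ball 0 Lemniscatic.r) →
          EqOn s s₀ (ball 0 Lemniscatic.r)) ∧
      (Lemniscatic.SolvesIVP s₀ c₀ (ball 0 Lemniscatic.r) ∧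
        ∀ s c : ℂ → ℂ, Lemniscatic.SolvesIVP s c (ball 0 Lemniscatic.r) →
          EqOn s s₀ (ball 0 Lemniscatic.r) ∧ EqOn c c₀ (ball 0 Lemniscatic.r)) ∧
      -- the numbers `K` and `L`
      (K ∈ Ioo (0 : ℝ) 1 ∧ Lemniscatic.dup s₀ (Lemniscatic.γ * K) = Lemniscatic.γ ∧
        ∀ K' ∈ Ioo (0 : ℝ) 1,
          Lemniscatic.dup s₀ (Lemniscatic.γ * K') = Lemniscatic.γ → K' = K) ∧
      (L ∈ Icc (0 : ℝ) (Real.pi / 2) ∧ Lemniscatic.dup (Lemniscatic.dup s₀) L = 1 ∧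
        ∀ L' ∈ Icc (0 : ℝ) (Real.pi / 2),
          Lemniscatic.dup (Lemniscatic.dup s₀) L' = 1 → L' = L) ∧
      -- `S` is meromorphic and extends the earlier versions; it is the only such function
      MeromorphicNFOn S univ ∧
      EqOn S s₀ (ball 0 Lemniscatic.r) ∧
      EqOn S (Lemniscatic.dup s₀) (ball 0 (2 * Lemniscatic.r)) ∧
      EqOn S (Lemniscatic.dup (Lemniscatic.dup s₀))
        (ball 0 (4 * Lemniscatic.r) \ Lemniscatic.basicPoles K) ∧
      (∀ T : ℂ → ℂ, MeromorphicNFOn T univ → EqOn T s₀ (ball 0 Lemniscatic.r) → T = S) ∧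
      -- double periodicity
      0 < L ∧ Function.Periodic S (4 * L) ∧ Function.Periodic S (4 * I * L) ∧
      -- the singularities
      (∀ z, z ∉ Lemniscatic.poles K L → AnalyticAt ℂ S z) ∧
      (∀ z ∈ Lemniscatic.poles K L, meromorphicOrderAt S z = -1) ∧
      -- the initial value problems for `s` alone
      S 0 = 0 ∧ deriv S 0 = 1 ∧
      (∀ z, z ∉ Lemniscatic.poles K L → deriv S z ^ 2 = 1 - S z ^ 4) ∧
      (∀ z, z ∉ Lemniscatic.poles K L → deriv (deriv S) z = -2 * S z ^ 3) ∧
      -- the initial value problem for `s` and `c` jointly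
      MeromorphicNFOn C univ ∧ EqOn C c₀ (ball 0 Lemniscatic.r) ∧
      (∀ z, z ∉ Lemniscatic.poles K L → 1 + S z ^ 2 ≠ 0 →
        HasDerivAt S (C z * (1 + S z ^ 2)) z ∧
        HasDerivAt C (-S z * (1 + C z ^ 2)) z ∧
        S z ^ 2 + S z ^ 2 * C z ^ 2 + C z ^ 2 = 1) ∧
      -- symmetries
      (∀ z, S (starRingEnd ℂ z) = starRingEnd ℂ (S z)) ∧
      (∀ z, S (-z) = -S z) ∧
      (∀ z, S (I * z) = I * S z) ∧
      (∀ z, S (2 * L - z) = S z) ∧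
      -- duplication formula
      (∀ z, z ∉ Lemniscatic.poles K L →
        (1 + S z ^ 4 = 0 ↔ 2 * z ∈ Lemniscatic.poles K L) ∧
        (1 + S z ^ 4 ≠ 0 → S (2 * z) = 2 * S z * deriv S z / (1 + S z ^ 4))) ∧
      -- complex multiplication by `√2 γ̄ = 1 - i`
      (∀ z, z ∉ Lemniscatic.poles K L →
        (1 - S z ^ 4 = 0 ↔
          (Real.sqrt 2 : ℂ) * starRingEnd ℂ Lemniscatic.γ * z ∈ Lemniscatic.poles K L) ∧
        (1 - S z ^ 4 ≠ 0 →
          S ((Real.sqrt 2 : ℂ) * starRingEnd ℂ Lemniscatic.γ * z) ^ 2 =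
            -2 * I * (S z ^ 2 / (1 - S z ^ 4)))) := by
  obtain ⟨S, hnf, hgerm⟩ := Lemniscatic.exists_meromorphicNFOn_sine
  have hS : Lemniscatic.IsSine S := ⟨hnf, hgerm⟩
  obtain ⟨K, hK, hSK, hKuniq⟩ := hS.exists_K
  set L : ℝ := Real.sqrt 2 * K with hLdef
  have hL : S L = 1 := hS.map_sqrt_two_mul hK hSK
  have hsqrt : 0 < Real.sqrt 2 := by positivity
  have hsqrt1 : 1 < Real.sqrt 2 := by rw [Real.lt_sqrt] <;> norm_num
  have hsqrt2 : Real.sqrt 2 < 3 / 2 := by rw [Real.sqrt_lt'] <;> norm_num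
  have hL1 : 1 ≤ L := by
    rw [← Lemniscatic.sqrt_two_mul_r]
    exact mul_le_mul_of_nonneg_left (hS.r_le_K hK.1 hSK) hsqrt.le
  have hL0 : 0 < L := zero_lt_one.trans_le hL1
  have hL2 : L < Real.sqrt 2 := by nlinarith [hK.2]
  have hpi := Real.pi_gt_three
  have hpi' := Real.pi_lt_d2
  have hr := Lemniscatic.two_mul_r
  have han : ∀ z, AnalyticAt ℂ S z ↔ z ∉ Lemniscatic.poles K L := hS.analyticAt_iff hLdef hL hL0 hL2
  have hdd : ∀ x ∈ Icc (0 : ℝ) (Real.pi / 2),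
      Lemniscatic.dup (Lemniscatic.dup S) x = S x := fun x hx => by
    refine hS.dup_dup_eq ?_
    rw [norm_real, Real.norm_of_nonneg hx.1]
    linarith [hx.2]
  have hγ : ∀ x ∈ Ioo (0 : ℝ) 1,
      Lemniscatic.dup S (Lemniscatic.γ * x) = S (Lemniscatic.γ * x) := fun x hx => by
    refine hS.dup_eq ?_
    rw [Lemniscatic.IsSine.norm_γ_mul, abs_of_pos hx.1]
    exact hx.2.trans hsqrt1
  have hLmem : L ∈ Icc (0 : ℝ) (Real.pi / 2) := ⟨hL0.le, by linarith⟩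
  -- The global functions serve also as the functions on the small disc, and c is S(L - z).
  refine ⟨S, fun z => S (L - z), K, L, S, fun z => S (L - z),
    ⟨hS.solvesSineIVP, fun s hs => hS.eqOn_of_solvesSineIVP hs⟩,
    ⟨hS.solvesIVP hL, fun s c h => hS.eqOn_of_solvesIVP hL h⟩,
    ⟨hK, (hγ K hK).trans hSK, fun K' hK' h => hKuniq K' hK' ((hγ K' hK').symm.trans h)⟩,
    ⟨hLmem, (hdd L hLmem).trans hL, fun L' hL' h => ?_⟩, hnf, fun _ _ => rfl,
    fun z hz => (hS.dup_eq ?_).symm, fun z hz => (hS.dup_dup_eq ?_).symm,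
    fun T hT h => ?_, hL0, fun z => ?_, fun z => ?_, fun z hz => (han z).2 hz,
    fun z hz => hS.order_of_mem_poles hLdef hL hz, hS.map_zero, hgerm.deriv_zero,
    fun z hz => hS.deriv_sq ((han z).2 hz), fun z hz => hS.deriv_deriv ((han z).2 hz),
    ?_, fun _ _ => rfl, fun z hz h => hS.joint hL ((han z).2 hz) h, hS.map_conj, hS.map_neg,
    hS.map_I_mul, hS.map_two_mul_sub hL, fun z hz => ?_, fun z hz => ?_⟩
  · rw [hdd L' hL'] at h
    -- Both r ≤ L' ≤ π/2 and 1 ≤ L < √2, so |L' - L| < 1.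
    have hrL := hS.r_le_of_map_eq_one hL'.1 h
    refine hS.eq_of_map_eq_one hL h ?_
    rw [abs_lt]
    constructor <;> linarith [hL'.2]
  · rw [← hr]
    simpa using hz
  · rw [← hr]
    have : ‖z‖ < 4 * Lemniscatic.r := by simpa using hz.1
    linarith
  · refine Lemniscatic.eq_of_meromorphicNFOn hT hnf (x := 0) ?_
    exact (h.eventuallyEq_of_mem (ball_mem_nhds 0 Lemniscatic.r_pos)).filter_mono
      nhdsWithin_le_nhds
  · rw [show z + 4 * L = z + 2 * L + 2 * L by ring, hS.antiperiodic hL, hS.antiperiodic hL,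
      neg_neg]
  · rw [show z + 4 * I * L = z + 2 * I * L + 2 * I * L by ring, hS.antiperiodic_I hL,
      hS.antiperiodic_I hL, neg_neg]
  · intro z hz
    simpa [sub_eq_neg_add] using Lemniscatic.meromorphicNFOn_comp_affine hnf (-1) L hz
  · have ha := (han z).2 hz
    refine ⟨⟨fun h => ?_, fun h => ?_⟩, fun h => (hS.map_two_mul ha h).2⟩
    · by_contra h2
      exact hS.not_analyticAt_two_mul ha h ((han _).2 h2)
    · by_contra h2
      exact (han _).1 (hS.map_two_mul ha h2).1 h
  · have ha := (han z).2 hz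
    rw [Lemniscatic.sqrt_two_mul_conj_γ]
    refine ⟨⟨fun h => ?_, fun h => ?_⟩, fun h => ?_⟩
    · by_contra h2
      exact hS.not_analyticAt_one_sub_I_mul ha h ((han _).2 h2)
    · by_contra h2
      exact (han _).1 (hS.map_one_sub_I_mul ha h2).1 h
    · rw [(hS.map_one_sub_I_mul ha h).2, div_pow, hS.deriv_sq ha, mul_pow,
        show (1 - I) ^ 2 = -2 * I by linear_combination I_sq]
      ring
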